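/- **Setting.** Let $k,n\in\mathbb N$, let $\mathbb T^k=[-1/2,1/2)^k$ with Lebesgue measure, $T_\ell f(x)=f(x-\ell)$ for $\ell\in\mathbb Z^k$, $f\in L^2(\mathbb R^k)$, and let $\Gamma:L^2(\mathbb R^k)\to L^2(\mathbb T^k,\ell^2(\mathbb Z^k))$, $\Gamma f(x)=(\hat f(x+\ell))_{\ell\in\mathbb Z^k}$. A closed subspace $\mathcal V\subseteq L^2(\mathbb R^k)$ is shift-invariant (SI) if $T_\ell\mathcal V\subseteq\mathcal V$ for all $\ell\in\mathbb Z^k$; its range function is $J_{\mathcal V}(x)=\overline{\mathrm{span}}\{\Gamma h_j(x):j\in\mathbb N\}\subseteq\ell^2(\mathbb Z^k)$, where $(h_j)_j$ is any dense sequence in $\mathcal V$ (well defined up to a null set of $x\in\mathbb T^k$). Put $d(x)=\dim J_{\mathcal V}(x)$ and $\mathrm{Spec}(\mathcal V)=\{x\in\mathbb T^k: J_{\mathcal V}(x)\neq\{0\}\}$. A bounded operator $S$ on $L^2(\mathbb R^k)$ is shift-preserving (SP) if $ST_\ell=T_\ell S$ for all $\ell\in\mathbb Z^k$; then $[S]_x$,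 $x\in\mathbb T^k$, denotes the (a.e. unique) weakly measurable, essentially bounded field of bounded operators on $\ell^2(\mathbb Z^k)$ with $[S]_x(\Gamma f(x))=\Gamma(Sf)(x)$ for a.e. $x$, for every $f\in L^2(\mathbb R^k)$. For a positive finite rank operator $T$ on $\ell^2(\mathbb Z^k)$, $\lambda(T)=(\lambda_i(T))_{i\ge1}$ is the non-increasing sequence of its eigenvalues, counted with multiplicity and followed by zeros. Let $\mathcal V$ be an SI space and let $\mathcal G=(g_i)_{i=1}^n$ be such that $E(\mathcal G)=\{T_\ell g_i:\ell\in\mathbb Z^k,\ 1\le i\le n\}$ is a frame for $\mathcal V$, with frame operator $S=S_{E(\mathcal G)}$. Define $$U_{\mathcal V}(E(\mathcal G))=\{S+B:\ B\ge0 \text{ a bounded SP operator on } L^2(\mathbb R^k),\ R(B)\subseteq\mathcal V,\ \mathrm{rank}([B]_x)\le n-d(x)\text{ for a.e. }x\in\mathbb T^k\}.$$ **Theorem.** Let $X\subseteq\mathbb T^k$ be Lebesgue measurable with $\mathrm{Spec}(\mathcal V)\subseteq X$ up to a null set, let $m(x)=2d(x)-n$, and let $\mu=(\mu_i)_{i\ge1}$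 be a measurable function on $X$ whose values are non-increasing, non-negative, summable sequences. The following are equivalent. 1. There exists $C\in U_{\mathcal V}(E(\mathcal G))$ such that $\mu(x)=\lambda([C]_x)$ for a.e. $x\in X$. 2. $\mu_1$ is essentially bounded on $X$, and for a.e. $x\in X$: if $x\notin\mathrm{Spec}(\mathcal V)$ then $\mu(x)=0$; if $x\in\mathrm{Spec}(\mathcal V)$ then $\mu_i(x)=0$ for all $i\ge d(x)+1$ and - (a) if $m(x)\le0$, then $\mu_i(x)\ge\lambda_i([S]_x)$ for $1\le i\le d(x)$; - (b) if $m(x)\ge1$, then $\mu_i(x)\ge\lambda_i([S]_x)$ for $1\le i\le d(x)$, and $\mu_{n-d(x)+i}(x)\le\lambda_i([S]_x)$ for $1\le i\le m(x)$. -/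

import Mathlib

open MeasureTheory Filter
open scoped ENNReal FourierTransform

noncomputable section

namespace SISpace

/-! ### Frames in a Hilbert space -/

section Frames

variable {ι H : Type*} [NormedAddCommGroup H] [InnerProductSpace ℂ H]

/-- `F` is a Bessel sequence: `∑ i, |⟨f, F i⟩|² ≤ b ‖f‖²` for all `f ∈ H`, for some constant `b`. -/
def IsBessel (F : ι → H) : Prop :=
  ∃ b : ℝ, 0 < b ∧ ∀ f : H, Summable (fun i => ‖inner ℂ (F i) f‖ ^ 2) ∧
    ∑' i, ‖inner ℂ (F i) f‖ ^ 2 ≤ b * ‖f‖ ^ 2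

/-- `F` is a frame for the subspace `W`: it is a family in `W` and
`a ‖f‖² ≤ ∑ i, |⟨f, F i⟩|² ≤ b ‖f‖²` for all `f ∈ W`, for some constants `0 < a ≤ b`. -/
def IsFrameFor (F : ι → H) (W : Submodule ℂ H) : Prop :=
  (∀ i, F i ∈ W) ∧ ∃ a b : ℝ, 0 < a ∧ a ≤ b ∧ ∀ f ∈ W,
    Summable (fun i => ‖inner ℂ (F i) f‖ ^ 2) ∧
    a * ‖f‖ ^ 2 ≤ ∑' i, ‖inner ℂ (F i) f‖ ^ 2 ∧
    ∑' i, ‖inner ℂ (F i) f‖ ^ 2 ≤ b * ‖f‖ ^ 2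

theorem IsBessel.memℓp {F : ι → H} (hF : IsBessel F) (f : H) :
    Memℓp (fun i => inner ℂ (F i) f) 2 := by
  obtain ⟨b, -, h⟩ := hF
  refine memℓp_gen ?_
  simpa using (h f).1

/-- The analysis operator `f ↦ (⟨f, F i⟩)_i` of a Bessel sequence, with values in `ℓ²(ι)`. -/
def analysisOp (F : ι → H) (hF : IsBessel F) : H →L[ℂ] lp (fun _ : ι => ℂ) 2 :=
  LinearMap.mkContinuousOfExistsBound
    { toFun := fun f => ⟨fun i => inner ℂ (F i) f, hF.memℓp f⟩
      map_add' := fun f g => by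
        ext i
        exact inner_add_right _ _ _
      map_smul' := fun c f => by
        ext i
        exact inner_smul_right _ _ _ }
    (by
      obtain ⟨b, hb, h⟩ := hF
      refine ⟨Real.sqrt b, fun f => ?_⟩
      refine lp.norm_le_of_tsum_le (by norm_num) (by positivity) ?_
      have h2 := (h f).2
      have e : (Real.sqrt b * ‖f‖) ^ 2 = b * ‖f‖ ^ 2 := by
        rw [mul_pow, Real.sq_sqrt hb.le]
      simpa [e] using h2)

variable [CompleteSpace H]

open Classical in
/-- The frame operator `S_F = T_F T_F^*` of a Bessel sequence `F`, where `T_F^*` is the analysis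
operator and `T_F` (its adjoint) is the synthesis operator.  So `S_F f = ∑ i, ⟨f, F i⟩ F i`. -/
def frameOp (F : ι → H) : H →L[ℂ] H :=
  if hF : IsBessel F then
    (ContinuousLinearMap.adjoint (analysisOp F hF)).comp (analysisOp F hF)
  else 0

end Frames

/-! ### Shift-invariant subspaces of `L²(ℝᵏ)` and the fiberization map -/

/-- `ℝᵏ`. -/
abbrev RSpace (k : ℕ) : Type := EuclideanSpace ℝ (Fin k)

/-- The Hilbert space `L²(ℝᵏ)` of complex valued functions. -/
abbrev L2 (k : ℕ) : Type := Lp ℂ 2 (volume : Measure (RSpace k))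

/-- The Hilbert space `ℓ²(ℤᵏ)`. -/
abbrev Seq2 (k : ℕ) : Type := lp (fun _ : Fin k → ℤ => ℂ) 2

/-- An integer vector as an element of `ℝᵏ`. -/
def intVec {k : ℕ} (l : Fin k → ℤ) : RSpace k := WithLp.toLp 2 (fun i => (l i : ℝ))

/-- The integer translation `(T_l f)(x) = f (x - l)` on `L²(ℝᵏ)`. -/
def shift {k : ℕ} (l : Fin k → ℤ) : L2 k →ₗᵢ[ℂ] L2 k :=
  Lp.compMeasurePreservingₗᵢ ℂ (fun x => x - intVec l)
    (measurePreserving_sub_right volume (intVec l))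

/-- Closed subspaces of `L²(ℝᵏ)` invariant under integer translations. -/
def IsShiftInvariant {k : ℕ} (V : Submodule ℂ (L2 k)) : Prop :=
  IsClosed (V : Set (L2 k)) ∧ ∀ (l : Fin k → ℤ), ∀ f ∈ V, shift l f ∈ V

/-- Bounded operators commuting with integer translations. -/
def IsShiftPreserving {k : ℕ} (S : L2 k →L[ℂ] L2 k) : Prop :=
  ∀ (l : Fin k → ℤ) (f : L2 k), S (shift l f) = shift l (S f)

/-- The family of translates `E(G) = {T_l g_i}` of a finite sequence `G = (g_i)`. -/
def translates {k n : ℕ} (g : Fin n → L2 k) : (Fin k → ℤ) × Fin n → L2 k :=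
  fun p => shift p.1 (g p.2)

/-- The fundamental cube `[-1/2, 1/2)ᵏ`. -/
def torus (k : ℕ) : Set (RSpace k) := {x | ∀ i, x i ∈ Set.Ico (-(1 / 2) : ℝ) (1 / 2)}

open Classical in
/-- The fiberization `Γ f (x) = (f̂ (x + l))_{l ∈ ℤᵏ} ∈ ℓ²(ℤᵏ)`, where `f̂` is the Fourier
transform on `L²(ℝᵏ)` (the sequence is square summable for almost every `x`). -/
def Gam {k : ℕ} (f : L2 k) (x : RSpace k) : Seq2 k :=
  if h : Memℓp (fun l : Fin k → ℤ => (𝓕 f : L2 k) (x + intVec l)) 2 then ⟨_, h⟩ else 0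

instance instFactTwoNeTop : Fact ((2 : ℝ≥0∞) ≠ ∞) := ⟨by norm_num⟩

/-- The range function `J_V(x)` of a shift-invariant space `V`: the closed linear span of
`{Γ h_j (x)}`, where `(h_j)` is a sequence which is dense in `V` (in particular it generates `V`).
It is determined by `V` up to a null set of points `x`. -/
def rangeFn {k : ℕ} (V : Submodule ℂ (L2 k)) (x : RSpace k) : Submodule ℂ (Seq2 k) :=
  (Submodule.span ℂ (Set.range fun j : ℕ =>
    Gam ((TopologicalSpace.denseSeq V j : V) : L2 k) x)).topologicalClosure

/-- `d(x) = dim J_V(x)`. -/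
def dimFn {k : ℕ} (V : Submodule ℂ (L2 k)) (x : RSpace k) : ℕ :=
  Module.finrank ℂ (rangeFn V x)

/-- `Spec(V) = {x : J_V(x) ≠ 0}`. -/
def Spec {k : ℕ} (V : Submodule ℂ (L2 k)) : Set (RSpace k) :=
  {x | x ∈ torus k ∧ rangeFn V x ≠ ⊥}

/-- `s` is a weakly measurable, essentially bounded field of operators on `ℓ²(ℤᵏ)` over the cube
such that `s(x) (Γ f (x)) = Γ (S f) (x)` for a.e. `x`, for every `f ∈ L²(ℝᵏ)`. -/
def IsFiberField {k : ℕ} (S : L2 k →L[ℂ] L2 k) (s : RSpace k → (Seq2 k →L[ℂ] Seq2 k)) : Prop :=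
  (∀ ξ η : Seq2 k, AEMeasurable (fun x => inner ℂ η (s x ξ)) (volume.restrict (torus k))) ∧
  (∃ M : ℝ, ∀ᵐ x ∂(volume.restrict (torus k)), ‖s x‖ ≤ M) ∧
  ∀ f : L2 k, ∀ᵐ x ∂(volume.restrict (torus k)), s x (Gam f x) = Gam (S f) x

open Classical in
/-- The field of operators `[S]_x` associated with a shift-preserving operator `S`; it is
determined by `S` up to a null set of points `x`. -/
def fiber {k : ℕ} (S : L2 k →L[ℂ] L2 k) : RSpace k → (Seq2 k →L[ℂ] Seq2 k) :=
  if h : ∃ s, IsFiberField S s then h.choose else 0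

/-- The `j`-th eigenvalue (`j = 0, 1, 2, …`) of a positive finite rank operator `T` on `ℓ²(ℤᵏ)`,
the eigenvalues being listed in non-increasing order, with multiplicities (and followed by zeros):
it is the largest `t ≥ 0` such that more than `j` eigenvalues of `T`, counted with the dimensions
of their eigenspaces, are `≥ t`; and it is `0` if there is no such `t`. -/
def eigSeq {k : ℕ} (T : Seq2 k →L[ℂ] Seq2 k) (j : ℕ) : ℝ :=
  sSup {t : ℝ | 0 ≤ t ∧ j < Module.finrank ℂ
    (⨆ (s : ℝ) (_ : t ≤ s), Module.End.eigenspace (T : Seq2 k →ₗ[ℂ] Seq2 k) (s : ℂ) :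
      Submodule ℂ (Seq2 k))}

/-- The set `U_V(E(G))` of the operators `S_{E(G)} + B`, where `B` is a positive shift-preserving
operator on `L²(ℝᵏ)` with `R(B) ⊆ V` and `rank [B]_x ≤ n - d(x)`, i.e. `rank [B]_x + d(x) ≤ n`,
for a.e. `x`. -/
def USet {k n : ℕ} (V : Submodule ℂ (L2 k)) (g : Fin n → L2 k) : Set (L2 k →L[ℂ] L2 k) :=
  {C | ∃ B : L2 k →L[ℂ] L2 k, B.IsPositive ∧ IsShiftPreserving B ∧ (∀ f, B f ∈ V) ∧
    (∀ᵐ x ∂(volume.restrict (torus k)),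
      LinearMap.rank (fiber B x : Seq2 k →ₗ[ℂ] Seq2 k) + (dimFn V x : Cardinal) ≤ (n : Cardinal)) ∧
    C = frameOp (translates g) + B}

end SISpace

end

/-! The fiberization `Gam` is a unitary map from `L²(ℝᵏ)` onto `L²(𝕋ᵏ, ℓ²(ℤᵏ))` (`gamLp`,
`exists_gam_eq`) which turns translations into multiplication by characters (`gam_shift`).
Coefficients against translates of one function are then Fourier coefficients on the cube. By
Parseval (`hasSum_parseval`) the frame operator acts fiberwise as the finite sum `∑ γ i (γ i)*`,
where `γ i = Gam (g i) x` (`gam_mixedFrameOp`), and `J_V(x)` is the span of the `γ i`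
(`rangeFn_eq_span`). The theorem thus becomes a matrix problem at almost every `x`, together with
measurability and boundedness.

Necessity. A positive shift-preserving `B` with range in `V` vanishes on `Vᗮ`, so it has a field of
finite rank fibers (`exists_rankSum_isFiberField`), and these are positive
(`IsFiberField.isPositive`). With `r = n - d(x)`, Weyl's inequalities give `λ_i ≤ μ_i`
(`IsSpectral.mono`) and `μ_{r+i} ≤ λ_i` (`IsSpectral.le_of_finrank_range_le`). Since `μ` vanishes
beyond `d(x)`, the second family has content only for `i ≤ m(x)`, which explains the cases (a) and
(b). The top eigenvalue is bounded by the norm of the fiber.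

Sufficiency. The same interlacing suffices for an `r`-fold sum of positive rank one perturbations to
exist. For `r = 1` and strict interlacing the perturbation is read off from the secular equation;
compactness removes strictness (`exists_isRankOneUpdate`), and induction on `r` gives
`exists_finite_rank_update`. To choose the perturbing vectors measurably, they are written as
combinations of the `γ i`. The admissible coefficients form a closed relation over the Gram matrix
and `μ(x)`, all in finite-dimensional spaces, so a measurable selection exists
(`exists_measurable_completion`). The resulting fields are bounded because `μ_1` is
(`IsCompletion.norm_combine_sq_le`); hence they are fibers of functions `φ j ∈ V`, and `B` is the
frame operator of the translates of `φ`. -/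

noncomputable section

namespace SISpace

section

/-! ### The cube as a fundamental domain -/

/-- Lebesgue measure on the fundamental cube. -/
abbrev torusVol (k : ℕ) : Measure (RSpace k) := volume.restrict (torus k)

theorem measurableSet_torus (k : ℕ) : MeasurableSet (torus k) := by
  have : torus k = ⋂ i : Fin k, (fun x : RSpace k => x i) ⁻¹' Set.Ico (-(1 / 2) : ℝ) (1 / 2) := by
    ext x; simp [torus]
  rw [this]
  exact MeasurableSet.iInter fun i => (by fun_prop : Measurable fun x : RSpace k => x i)
    measurableSet_Ico

theorem intVec_apply {k : ℕ} (l : Fin k → ℤ) (i : Fin k) : intVec l i = l i := rfl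

/-- The integer part of a point with respect to the tiling by translates of the cube. -/
def cell {k : ℕ} (y : RSpace k) : Fin k → ℤ := fun i => ⌊y i + 1 / 2⌋

theorem sub_intVec_mem_torus_iff {k : ℕ} (y : RSpace k) (l : Fin k → ℤ) :
    y - intVec l ∈ torus k ↔ cell y = l := by
  simp only [torus, Set.mem_ofPred_eq, PiLp.sub_apply, intVec_apply, Set.mem_Ico, funext_iff, cell,
    Int.floor_eq_iff]
  exact forall_congr' fun i => ⟨fun h => ⟨by linarith [h.1], by linarith [h.2]⟩,
    fun h => ⟨by linarith [h.1], by linarith [h.2]⟩⟩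

theorem cell_add_intVec {k : ℕ} {x : RSpace k} (hx : x ∈ torus k) (l : Fin k → ℤ) :
    cell (x + intVec l) = l := by
  rw [← sub_intVec_mem_torus_iff]; simpa using hx

/-- The integer translates of the half-open cube tile `ℝᵏ` exactly, so no measurability of `h` is
needed. -/
theorem lintegral_eq_tsum_torus {k : ℕ} (h : RSpace k → ℝ≥0∞) :
    ∫⁻ y, h y = ∑' l : Fin k → ℤ, ∫⁻ x, h (x + intVec l) ∂(torusVol k) := by
  have hU : (⋃ l : Fin k → ℤ, (fun y : RSpace k => y - intVec l) ⁻¹' torus k) = Set.univ := by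
    refine Set.eq_univ_of_forall fun y => Set.mem_iUnion.2 ⟨cell y, ?_⟩
    exact (sub_intVec_mem_torus_iff y _).2 rfl
  rw [← setLIntegral_univ, ← hU, lintegral_iUnion]
  · refine tsum_congr fun l => ?_
    have := (measurePreserving_sub_right (volume : Measure (RSpace k))
      (intVec l)).setLIntegral_comp_preimage_emb (MeasurableEquiv.subRight _).measurableEmbedding
      (fun x => h (x + intVec l)) (torus k)
    simpa using this
  · exact fun l => measurable_id.sub_const _ (measurableSet_torus k)
  · intro l m hlm
    refine Set.disjoint_left.2 fun y hy hy' => hlm ?_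
    exact ((sub_intVec_mem_torus_iff y _).1 hy).symm.trans ((sub_intVec_mem_torus_iff y _).1 hy')

theorem ae_torus_of_ae {k : ℕ} {p : RSpace k → Prop} (h : ∀ᵐ y, p y) :
    ∀ᵐ x ∂(torusVol k), ∀ l : Fin k → ℤ, p (x + intVec l) :=
  ae_restrict_of_ae <| ae_all_iff.2 fun l =>
    (measurePreserving_add_right (volume : Measure (RSpace k))
      (intVec l)).quasiMeasurePreserving.ae h

theorem ae_mem_torus (k : ℕ) : ∀ᵐ x ∂(torusVol k), x ∈ torus k :=
  ae_restrict_mem (measurableSet_torus k)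

instance instIsFiniteMeasureTorusVol (k : ℕ) : IsFiniteMeasure (torusVol k) := by
  refine ⟨?_⟩
  rw [Measure.restrict_apply_univ]
  refine (Bornology.IsBounded.measure_lt_top ?_)
  refine (Metric.isBounded_iff_subset_closedBall (0 : RSpace k)).2 ⟨Real.sqrt k, fun x hx => ?_⟩
  rw [mem_closedBall_zero_iff, EuclideanSpace.norm_eq]
  refine Real.sqrt_le_sqrt ?_
  calc ∑ i, ‖x i‖ ^ 2 ≤ ∑ _i : Fin k, (1 : ℝ) := by
        refine Finset.sum_le_sum fun i _ => ?_
        have := hx i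
        rw [Real.norm_eq_abs, sq_abs]
        nlinarith [this.1, this.2]
    _ = k := by simp

/-! ### Square summable sequences -/

theorem enorm_sq_seq2 {k : ℕ} (a : Seq2 k) : ‖a‖ₑ ^ 2 = ∑' l, ‖a l‖ₑ ^ 2 := by
  have h := lp.hasSum_norm (p := 2) (by norm_num) a
  simp only [ENNReal.toReal_ofNat, Real.rpow_ofNat] at h
  have e : ∀ {E : Type} [NormedAddCommGroup E] (z : E), ‖z‖ₑ ^ 2 = ENNReal.ofReal (‖z‖ ^ 2) :=
    fun z => by rw [← ofReal_norm, ENNReal.ofReal_pow (norm_nonneg z)]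
  simp only [e]
  rw [← h.tsum_eq, ENNReal.ofReal_tsum_of_nonneg (fun _ => by positivity) h.summable]

theorem memℓp_two_of_tsum_enorm_ne_top {ι : Type*} {a : ι → ℂ} (h : ∑' l, ‖a l‖ₑ ^ 2 ≠ ∞) :
    Memℓp a 2 := by
  refine memℓp_gen ?_
  have := ENNReal.summable_toReal h
  simpa using this

/-- Truncations to finitely many coordinates converge pointwise in `ℓ²`, and each truncation is a
finite sum of measurable terms. -/
theorem aestronglyMeasurable_seq2 {k : ℕ} {α : Type*} {mα : MeasurableSpace α} {ν : Measure α}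
    {Φ : α → Seq2 k} (h : ∀ l, AEStronglyMeasurable (fun x => Φ x l) ν) :
    AEStronglyMeasurable Φ ν := by
  classical
  refine aestronglyMeasurable_of_tendsto_ae (atTop : Filter (Finset (Fin k → ℤ)))
    (f := fun s x => ∑ l ∈ s, lp.single 2 l (Φ x l)) (fun s => ?_)
    (Eventually.of_forall fun x => lp.hasSum_single (by norm_num) (Φ x))
  refine Finset.aestronglyMeasurable_fun_sum _ fun l _ => ?_
  have hc : Continuous fun z : ℂ => (lp.single 2 l z : Seq2 k) :=
    (lp.singleContinuousLinearMap ℂ (fun _ : Fin k → ℤ => ℂ) 2 l).continuous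
  exact hc.comp_aestronglyMeasurable (h l)

/-! ### The fiberization map -/

variable {k : ℕ}

theorem lintegral_tsum_fourier (f : L2 k) :
    ∫⁻ x, ∑' l : Fin k → ℤ, ‖(𝓕 f : L2 k) (x + intVec l)‖ₑ ^ 2 ∂(torusVol k) = ‖f‖ₑ ^ 2 := by
  rw [lintegral_tsum]
  · rw [← lintegral_eq_tsum_torus fun y => ‖(𝓕 f : L2 k) y‖ₑ ^ 2]
    have : ‖f‖ₑ = ‖(𝓕 f : L2 k)‖ₑ := by
      rw [← ofReal_norm, ← ofReal_norm, Lp.norm_fourier_eq]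
    rw [this, Lp.enorm_def, eLpNorm_eq_lintegral_rpow_enorm_toReal (by norm_num) (by norm_num),
      ← ENNReal.rpow_natCast, ← ENNReal.rpow_mul]
    simp
  · intro l
    have : AEStronglyMeasurable (fun x => (𝓕 f : L2 k) (x + intVec l)) (torusVol k) :=
      ((Lp.aestronglyMeasurable (𝓕 f : L2 k)).comp_quasiMeasurePreserving
        (measurePreserving_add_right volume (intVec l)).quasiMeasurePreserving).restrict
    exact this.enorm.pow_const 2

/-- The integral in `lintegral_tsum_fourier` is finite, so the default value `0` in `Gam` is taken
only on a null set. -/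
theorem gam_apply_ae (f : L2 k) :
    ∀ᵐ x ∂(torusVol k), ∀ l, Gam f x l = (𝓕 f : L2 k) (x + intVec l) := by
  have h : ∀ᵐ x ∂(torusVol k), ∑' l : Fin k → ℤ, ‖(𝓕 f : L2 k) (x + intVec l)‖ₑ ^ 2 < ∞ := by
    refine ae_lt_top' ?_ ?_
    · refine AEMeasurable.tsum fun l => ?_
      have : AEStronglyMeasurable (fun x => (𝓕 f : L2 k) (x + intVec l)) (torusVol k) :=
        ((Lp.aestronglyMeasurable (𝓕 f : L2 k)).comp_quasiMeasurePreserving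
          (measurePreserving_add_right volume (intVec l)).quasiMeasurePreserving).restrict
      exact this.enorm.pow_const 2
    · rw [lintegral_tsum_fourier]
      finiteness
  filter_upwards [h] with x hx l
  have := memℓp_two_of_tsum_enorm_ne_top hx.ne
  rw [Gam, dif_pos this]

theorem aestronglyMeasurable_gam (f : L2 k) : AEStronglyMeasurable (Gam f) (torusVol k) := by
  refine aestronglyMeasurable_seq2 fun l => ?_
  have : AEStronglyMeasurable (fun x => (𝓕 f : L2 k) (x + intVec l)) (torusVol k) :=
    ((Lp.aestronglyMeasurable (𝓕 f : L2 k)).comp_quasiMeasurePreserving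
      (measurePreserving_add_right volume (intVec l)).quasiMeasurePreserving).restrict
  refine this.congr ?_
  filter_upwards [gam_apply_ae f] with x hx using (hx l).symm

theorem lintegral_enorm_gam_sq (f : L2 k) :
    ∫⁻ x, ‖Gam f x‖ₑ ^ 2 ∂(torusVol k) = ‖f‖ₑ ^ 2 := by
  rw [← lintegral_tsum_fourier]
  refine lintegral_congr_ae ?_
  filter_upwards [gam_apply_ae f] with x hx
  rw [enorm_sq_seq2]
  exact tsum_congr fun l => by rw [hx l]

theorem eLpNorm_two_eq {α E : Type*} {mα : MeasurableSpace α} {ν : Measure α}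
    [NormedAddCommGroup E] (F : α → E) :
    eLpNorm F 2 ν = (∫⁻ x, ‖F x‖ₑ ^ 2 ∂ν) ^ (1 / 2 : ℝ) := by
  rw [eLpNorm_eq_lintegral_rpow_enorm_toReal (by norm_num) (by norm_num)]
  simp

theorem eLpNorm_gam (f : L2 k) : eLpNorm (Gam f) 2 (torusVol k) = ‖f‖ₑ := by
  rw [eLpNorm_two_eq, lintegral_enorm_gam_sq, ← ENNReal.rpow_natCast, ← ENNReal.rpow_mul]
  simp

theorem memLp_gam (f : L2 k) : MemLp (Gam f) 2 (torusVol k) :=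
  ⟨aestronglyMeasurable_gam f, by rw [eLpNorm_gam]; finiteness⟩

theorem gam_add (f g : L2 k) :
    ∀ᵐ x ∂(torusVol k), Gam (f + g) x = Gam f x + Gam g x := by
  have h : ∀ᵐ y, (𝓕 (f + g) : L2 k) y = (𝓕 f : L2 k) y + (𝓕 g : L2 k) y := by
    rw [FourierTransform.fourier_add]
    exact Lp.coeFn_add _ _
  filter_upwards [ae_torus_of_ae h, gam_apply_ae f, gam_apply_ae g, gam_apply_ae (f + g)]
    with x h1 h2 h3 h4
  ext l
  rw [lp.coeFn_add, Pi.add_apply, h2, h3, h4, h1]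

theorem gam_smul (c : ℂ) (f : L2 k) : ∀ᵐ x ∂(torusVol k), Gam (c • f) x = c • Gam f x := by
  have h : ∀ᵐ y, (𝓕 (c • f) : L2 k) y = c * (𝓕 f : L2 k) y := by
    rw [FourierTransform.fourier_smul]
    filter_upwards [Lp.coeFn_smul c (𝓕 f : L2 k)] with y hy
    rw [hy]; rfl
  filter_upwards [ae_torus_of_ae h, gam_apply_ae f, gam_apply_ae (c • f)] with x h1 h2 h3
  ext l
  rw [lp.coeFn_smul, Pi.smul_apply, h2, h3, h1, smul_eq_mul]

/-- The fiberization map as a linear isometry `L²(ℝᵏ) → L²(𝕋ᵏ, ℓ²(ℤᵏ))`. -/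
def gamLp (k : ℕ) : L2 k →ₗᵢ[ℂ] Lp (Seq2 k) 2 (torusVol k) where
  toFun f := (memLp_gam f).toLp
  map_add' f g := by
    rw [← MemLp.toLp_add, MemLp.toLp_eq_toLp_iff]
    exact gam_add f g
  map_smul' c f := by
    rw [RingHom.id_apply, ← MemLp.toLp_const_smul, MemLp.toLp_eq_toLp_iff]
    exact gam_smul c f
  norm_map' f := by
    change ‖(memLp_gam f).toLp‖ = _
    rw [Lp.norm_toLp, eLpNorm_gam, toReal_enorm]

theorem coeFn_gamLp (f : L2 k) : gamLp k f =ᵐ[torusVol k] Gam f := (memLp_gam f).coeFn_toLp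

theorem inner_eq_integral_gam (f g : L2 k) :
    inner ℂ f g = ∫ x, inner ℂ (Gam f x) (Gam g x) ∂(torusVol k) := by
  rw [← (gamLp k).inner_map_map f g, L2.inner_def]
  refine integral_congr_ae ?_
  filter_upwards [coeFn_gamLp f, coeFn_gamLp g] with x h1 h2
  rw [h1, h2]

theorem eq_of_gam_ae_eq {f g : L2 k} (h : ∀ᵐ x ∂(torusVol k), Gam f x = Gam g x) : f = g := by
  refine (gamLp k).injective (Lp.ext ?_)
  filter_upwards [coeFn_gamLp f, coeFn_gamLp g, h] with x h1 h2 h3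
  rw [h1, h2, h3]

/-- Surjectivity of the fiberization: the coordinate `Φ x l` is used as the value at `x + l`, which
by the tiling prescribes a function on `ℝᵏ`; its inverse Fourier transform is the required `f`. -/
theorem exists_gam_eq {Φ : RSpace k → Seq2 k} (hΦ : MemLp Φ 2 (torusVol k)) :
    ∃ f : L2 k, ∀ᵐ x ∂(torusVol k), Gam f x = Φ x := by
  set F : RSpace k → ℂ := fun y => Φ (y - intVec (cell y)) (cell y) with hF
  have hcell : ∀ x ∈ torus k, ∀ l, F (x + intVec l) = Φ x l := by
    intro x hx l
    simp [hF, cell_add_intVec hx]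
  have hmeas : AEStronglyMeasurable F volume := by
    have hU : (⋃ l : Fin k → ℤ, (fun y : RSpace k => y - intVec l) ⁻¹' torus k) = Set.univ := by
      refine Set.eq_univ_of_forall fun y => Set.mem_iUnion.2 ⟨cell y, ?_⟩
      exact (sub_intVec_mem_torus_iff y _).2 rfl
    rw [← Measure.restrict_univ (μ := (volume : Measure (RSpace k))), ← hU,
      aestronglyMeasurable_iUnion_iff]
    intro l
    have h1 : AEStronglyMeasurable (fun x => Φ x l) (torusVol k) :=
      (lp.evalCLM ℂ (fun _ : Fin k → ℤ => ℂ) 2 l).continuous.comp_aestronglyMeasurable hΦ.1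
    have h2 := h1.comp_measurePreserving
      ((measurePreserving_sub_right (volume : Measure (RSpace k))
        (intVec l)).restrict_preimage (measurableSet_torus k))
    refine h2.congr ?_
    filter_upwards [ae_restrict_mem ((measurable_id.sub_const (intVec l))
      (measurableSet_torus k))] with y hy
    have := (sub_intVec_mem_torus_iff y l).1 hy
    simp [hF, this]
  have hint : ∫⁻ y, ‖F y‖ₑ ^ 2 = ∫⁻ x, ‖Φ x‖ₑ ^ 2 ∂(torusVol k) := by
    rw [lintegral_eq_tsum_torus, ← lintegral_tsum]
    · refine lintegral_congr_ae ?_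
      filter_upwards [ae_mem_torus k] with x hx
      rw [enorm_sq_seq2]
      exact tsum_congr fun l => by rw [hcell x hx]
    · intro l
      have : AEStronglyMeasurable (fun x => F (x + intVec l)) (torusVol k) :=
        (hmeas.comp_quasiMeasurePreserving
          (measurePreserving_add_right volume (intVec l)).quasiMeasurePreserving).restrict
      exact this.enorm.pow_const 2
  have hL : MemLp F 2 volume := by
    refine ⟨hmeas, ?_⟩
    have := hΦ.2
    rw [eLpNorm_two_eq] at this ⊢
    rwa [hint]
  refine ⟨𝓕⁻ hL.toLp, ?_⟩
  filter_upwards [gam_apply_ae (𝓕⁻ hL.toLp : L2 k), ae_torus_of_ae hL.coeFn_toLp,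
    ae_mem_torus k] with x h1 h2 h3
  ext l
  rw [h1, FourierTransform.fourier_fourierInv_eq, h2, hcell x h3]

end

section

variable {k : ℕ}

/-! ### Characters, translations and the fiberization -/

/-- The character `x ↦ exp (2 π i l · x)`. -/
def chi (l : Fin k → ℤ) (x : RSpace k) : ℂ :=
  UnitAddTorus.mFourier l (fun i => (x i : UnitAddCircle))

theorem chi_eq_fourierChar (l : Fin k → ℤ) (x : RSpace k) :
    chi l x = (Real.fourierChar (inner ℝ (intVec l) x) : ℂ) := by
  have h : ∀ i, (fourier (l i)) ((x i : ℝ) : UnitAddCircle) =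
      Complex.exp (2 * Real.pi * Complex.I * l i * x i) := fun i => by
    rw [fourier_coe_apply]; simp
  simp only [chi, UnitAddTorus.mFourier, ContinuousMap.coe_mk, h,
    Real.fourierChar_apply, ← Complex.exp_sum]
  congr 1
  simp only [PiLp.inner_apply, intVec_apply, Real.inner_apply, Complex.ofReal_mul,
    Complex.ofReal_sum, Finset.mul_sum, Finset.sum_mul]
  refine Finset.sum_congr rfl fun i _ => ?_
  push_cast
  ring

theorem norm_chi (l : Fin k → ℤ) (x : RSpace k) : ‖chi l x‖ = 1 := by
  rw [chi_eq_fourierChar]; exact Circle.norm_coe _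

theorem continuous_chi (l : Fin k → ℤ) : Continuous (chi l) := by
  unfold chi
  have h : ∀ i : Fin k, Continuous fun x : RSpace k => (x i : UnitAddCircle) := fun i =>
    (AddCircle.continuous_mk' 1).comp (by fun_prop)
  exact (UnitAddTorus.mFourier l).continuous.comp (continuous_pi h)

theorem chi_add_intVec (l m : Fin k → ℤ) (x : RSpace k) : chi l (x + intVec m) = chi l x := by
  unfold chi
  congr 1
  ext i
  rw [PiLp.add_apply, intVec_apply, AddCircle.coe_add]
  have : ((m i : ℝ) : UnitAddCircle) = 0 := by
    rw [AddCircle.coe_eq_zero_iff]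
    exact ⟨m i, by simp⟩
  rw [this, add_zero]

theorem chi_neg (l : Fin k → ℤ) (x : RSpace k) : chi (-l) x = star (chi l x) :=
  UnitAddTorus.mFourier_neg

theorem memLp_chi_mul (l : Fin k → ℤ) {f : RSpace k → ℂ} {ν : Measure (RSpace k)}
    (hf : MemLp f 2 ν) : MemLp (fun x => chi l x * f x) 2 ν := by
  refine hf.of_le ((continuous_chi l).aestronglyMeasurable.mul hf.1) (Eventually.of_forall ?_)
  intro x
  rw [norm_mul, norm_chi, one_mul]

/-- Multiplication by a character on `L²(ℝᵏ)`. -/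
def modulate (l : Fin k → ℤ) : L2 k →ₗᵢ[ℂ] L2 k where
  toFun f := (memLp_chi_mul l (Lp.memLp f)).toLp
  map_add' f g := by
    rw [← MemLp.toLp_add, MemLp.toLp_eq_toLp_iff]
    filter_upwards [Lp.coeFn_add f g] with x hx
    rw [Pi.add_apply, hx, Pi.add_apply, mul_add]
  map_smul' c f := by
    rw [RingHom.id_apply, ← MemLp.toLp_const_smul, MemLp.toLp_eq_toLp_iff]
    filter_upwards [Lp.coeFn_smul c f] with x hx
    rw [Pi.smul_apply, hx, Pi.smul_apply, smul_eq_mul, smul_eq_mul, mul_left_comm]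
  norm_map' f := by
    change ‖(memLp_chi_mul l (Lp.memLp f)).toLp‖ = _
    rw [Lp.norm_toLp, Lp.norm_def]
    congr 1
    refine eLpNorm_congr_norm_ae (Eventually.of_forall fun x => ?_)
    rw [norm_mul, norm_chi, one_mul]

theorem coeFn_modulate (l : Fin k → ℤ) (f : L2 k) :
    ∀ᵐ x, modulate l f x = chi l x * f x := (memLp_chi_mul l (Lp.memLp f)).coeFn_toLp

theorem coeFn_shift (l : Fin k → ℤ) (f : L2 k) : ∀ᵐ x, shift l f x = f (x - intVec l) :=
  Lp.coeFn_compMeasurePreserving f (measurePreserving_sub_right volume (intVec l))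

theorem shift_toLp (l : Fin k → ℤ) (φ : SchwartzMap (RSpace k) ℂ) :
    shift l (φ.toLp 2) = (φ.compSubConstCLM ℂ (intVec l)).toLp 2 := by
  refine Lp.ext ?_
  filter_upwards [coeFn_shift l (φ.toLp 2), SchwartzMap.coeFn_toLp (φ.compSubConstCLM ℂ (intVec l)) 2,
    (measurePreserving_sub_right (volume : Measure (RSpace k))
      (intVec l)).quasiMeasurePreserving.ae (SchwartzMap.coeFn_toLp φ 2 volume)] with x h1 h2 h3
  rw [h1, h2, h3, SchwartzMap.compSubConstCLM_apply]

theorem fourier_shift_schwartz (l : Fin k → ℤ) (φ : SchwartzMap (RSpace k) ℂ) (y : RSpace k) :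
    (𝓕 (φ.compSubConstCLM ℂ (intVec l)) : SchwartzMap (RSpace k) ℂ) y =
      chi (-l) y * (𝓕 φ : SchwartzMap (RSpace k) ℂ) y := by
  have h := congrFun (VectorFourier.fourierIntegral_comp_add_right Real.fourierChar
    (volume : Measure (RSpace k)) (innerₗ (RSpace k)) φ (-intVec l)) y
  rw [SchwartzMap.fourier_coe, SchwartzMap.fourier_coe]
  have hl : intVec (-l) = -intVec l := by ext i; simp [intVec_apply]
  rw [chi_eq_fourierChar, hl]
  exact h

/-- Both sides are continuous in `f`, and on the dense set of Schwartz functions the Fourier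
transform is an honest integral. -/
theorem fourier_shift (l : Fin k → ℤ) (f : L2 k) :
    (𝓕 (shift l f) : L2 k) = modulate (-l) (𝓕 f : L2 k) := by
  refine DenseRange.induction_on
    (p := fun f : L2 k => (𝓕 (shift l f) : L2 k) = modulate (-l) (𝓕 f : L2 k))
    (SchwartzMap.denseRange_toLpCLM (E := RSpace k) (F := ℂ) (p := 2) (μ := volume)
      ENNReal.ofNat_ne_top) f ?_ ?_
  · refine isClosed_eq ?_ ?_
    · exact (Lp.fourierTransformₗᵢ (RSpace k) ℂ).continuous.comp (shift l).continuous
    · exact (modulate (-l)).continuous.comp (Lp.fourierTransformₗᵢ (RSpace k) ℂ).continuous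
  · intro φ
    rw [SchwartzMap.toLpCLM_apply, shift_toLp, SchwartzMap.toLp_fourier_eq,
      SchwartzMap.toLp_fourier_eq]
    refine Lp.ext ?_
    filter_upwards [coeFn_modulate (-l) ((𝓕 φ : SchwartzMap (RSpace k) ℂ).toLp 2),
      SchwartzMap.coeFn_toLp (𝓕 φ : SchwartzMap (RSpace k) ℂ) 2,
      SchwartzMap.coeFn_toLp (𝓕 (φ.compSubConstCLM ℂ (intVec l)) : SchwartzMap (RSpace k) ℂ) 2]
      with x h1 h2 h3
    rw [h1, h2, h3, fourier_shift_schwartz]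

theorem gam_shift (l : Fin k → ℤ) (f : L2 k) :
    ∀ᵐ x ∂(torusVol k), Gam (shift l f) x = chi (-l) x • Gam f x := by
  have h : ∀ᵐ y, (𝓕 (shift l f) : L2 k) y = chi (-l) y * (𝓕 f : L2 k) y := by
    rw [fourier_shift]; exact coeFn_modulate _ _
  filter_upwards [ae_torus_of_ae h, gam_apply_ae f, gam_apply_ae (shift l f)] with x h1 h2 h3
  ext m
  rw [lp.coeFn_smul, Pi.smul_apply, h2, h3, h1, chi_add_intVec, smul_eq_mul]

/-- The coefficients of `f` against the translates of `φ` are Fourier coefficients of the bracket `x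
↦ ⟨Gam φ x, Gam f x⟩`. This is what lets Parseval replace sums over translates by integrals over the
cube. -/
theorem inner_shift_eq_integral (l : Fin k → ℤ) (φ f : L2 k) :
    inner ℂ (shift l φ) f =
      ∫ x, chi l x * inner ℂ (Gam φ x) (Gam f x) ∂(torusVol k) := by
  rw [inner_eq_integral_gam]
  refine integral_congr_ae ?_
  filter_upwards [gam_shift l φ] with x hx
  rw [hx, inner_smul_left, chi_neg]
  simp

/-! ### Parseval's identity on the cube -/

section Parseval

local instance instMeasureSpaceUnitAddCircle : MeasureSpace UnitAddCircle :=
  ⟨AddCircle.haarAddCircle⟩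

/-- The point of `(-1/2, 1/2]ᵏ` above a point of the torus. -/
def torusSection (z : UnitAddTorus (Fin k)) : RSpace k :=
  WithLp.toLp 2 (UnitAddTorus.measurableEquivPiIoc (fun _ : Fin k => -(1 / 2 : ℝ)) z).1

/-- The two half-open conventions differ only on faces of the cube;
`UnitAddTorus.measurableEquivPiIoc` uses the one closed on the right. -/
theorem torus_ae_eq (k : ℕ) :
    torus k =ᵐ[volume] {x : RSpace k | ∀ i, x i ∈ Set.Ioc (-(1 / 2) : ℝ) (-(1 / 2) + 1)} := by
  have h := Measure.univ_pi_Ico_ae_eq_Icc (μ := fun _ : Fin k => (volume : Measure ℝ))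
    (f := fun _ => -(1 / 2)) (g := fun _ => 1 / 2)
  have h' := Measure.univ_pi_Ioc_ae_eq_Icc (μ := fun _ : Fin k => (volume : Measure ℝ))
    (f := fun _ => -(1 / 2)) (g := fun _ => 1 / 2)
  have h2 := (PiLp.volume_preserving_ofLp (Fin k)).quasiMeasurePreserving.preimage_ae_eq
    (h.trans h'.symm)
  have e1 : torus k = WithLp.ofLp ⁻¹' Set.univ.pi fun _ => Set.Ico (-(1 / 2) : ℝ) (1 / 2) := by
    ext x; simp [torus]
  have e2 : {x : RSpace k | ∀ i, x i ∈ Set.Ioc (-(1 / 2) : ℝ) (-(1 / 2) + 1)} =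
      WithLp.ofLp ⁻¹' Set.univ.pi fun _ => Set.Ioc (-(1 / 2) : ℝ) (1 / 2) := by
    ext x; norm_num
  rw [e1, e2]
  exact h2

theorem measurePreserving_torusSection :
    MeasurePreserving (torusSection (k := k)) volume (torusVol k) := by
  have h1 := UnitAddTorus.measurePreserving_equivPiIoc (fun _ : Fin k => -(1 / 2 : ℝ))
  have hm : MeasurableSet {x : Fin k → ℝ | ∀ i, x i ∈ Set.Ioc (-(1 / 2) : ℝ) (-(1 / 2) + 1)} := by
    exact MeasurableSet.univ_pi' fun i => measurableSet_Ioc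
  have h2 : MeasurePreserving
      (Subtype.val : {x : Fin k → ℝ // ∀ i, x i ∈ Set.Ioc (-(1 / 2) : ℝ) (-(1 / 2) + 1)} → _)
      (Measure.comap Subtype.val volume)
      (volume.restrict {x : Fin k → ℝ | ∀ i, x i ∈ Set.Ioc (-(1 / 2) : ℝ) (-(1 / 2) + 1)}) :=
    ⟨measurable_subtype_coe, map_comap_subtype_coe hm volume⟩
  have h3 := (PiLp.volume_preserving_toLp (Fin k)).restrict_preimage_emb
    (MeasurableEquiv.toLp 2 (Fin k → ℝ)).measurableEmbedding
    {x : RSpace k | ∀ i, x i ∈ Set.Ioc (-(1 / 2) : ℝ) (-(1 / 2) + 1)}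
  rw [torusVol, Measure.restrict_congr_set (torus_ae_eq k)]
  exact h3.comp (h2.comp h1)

theorem chi_torusSection (l : Fin k → ℤ) (z : UnitAddTorus (Fin k)) :
    chi l (torusSection z) = UnitAddTorus.mFourier l z := by
  unfold chi torusSection
  congr 1
  exact (UnitAddTorus.measurableEquivPiIoc (fun _ : Fin k => -(1 / 2 : ℝ))).symm_apply_apply z

/-- Parseval's identity for square integrable functions on the cube. -/
theorem hasSum_parseval {F H : RSpace k → ℂ} (hF : MemLp F 2 (torusVol k))
    (hH : MemLp H 2 (torusVol k)) :
    HasSum (fun l : Fin k → ℤ => star (∫ x, chi l x * F x ∂(torusVol k)) *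
      ∫ x, chi l x * H x ∂(torusVol k)) (∫ x, star (F x) * H x ∂(torusVol k)) := by
  have mp := measurePreserving_torusSection (k := k)
  have hF' := hF.comp_measurePreserving mp
  have hH' := hH.comp_measurePreserving mp
  -- `mFourierCoeff` integrates against the conjugate character, so the integral against `chi l` is
  -- the coefficient of index `-l`; the sum is reindexed by negation below.
  have coeff : ∀ {F : RSpace k → ℂ} (hF : MemLp F 2 (torusVol k)) (l : Fin k → ℤ),
      UnitAddTorus.mFourierCoeff ((hF.comp_measurePreserving mp).toLp) (-l) =
        ∫ x, chi l x * F x ∂(torusVol k) := by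
    intro F hF l
    have e := integral_map (μ := volume) mp.measurable.aemeasurable
      (f := fun x => chi l x * F x) (by
        rw [mp.map_eq]
        exact (continuous_chi l).aestronglyMeasurable.mul hF.1)
    rw [mp.map_eq] at e
    rw [e]
    · refine integral_congr_ae ?_
      filter_upwards [(hF.comp_measurePreserving mp).coeFn_toLp] with z hz
      rw [hz, neg_neg, chi_torusSection]; rfl
  have h := (Equiv.neg (Fin k → ℤ)).hasSum_iff.2
    (UnitAddTorus.hasSum_prod_mFourierCoeff hF'.toLp hH'.toLp)
  convert h using 1
  · ext l
    simp only [Function.comp_apply, Equiv.neg_apply, coeff hF, coeff hH]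
    rfl
  · have e := integral_map (μ := volume) mp.measurable.aemeasurable
      (f := fun x => star (F x) * H x) (by rw [mp.map_eq]; exact hF.1.star.mul hH.1)
    rw [mp.map_eq] at e
    rw [e]
    · refine integral_congr_ae ?_
      filter_upwards [hF'.coeFn_toLp, hH'.coeFn_toLp] with z h1 h2
      rw [h1, h2]; rfl

end Parseval

end

section

variable {k n : ℕ}

/-! ### Bessel families of translates -/

/-- The fiberization of `φ` is essentially bounded. -/
def EssBdd (φ : L2 k) : Prop := ∃ M : ℝ, ∀ᵐ x ∂(torusVol k), ‖Gam φ x‖ ≤ M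

theorem EssBdd.memLp_inner {φ : L2 k} (hφ : EssBdd φ) (f : L2 k) :
    MemLp (fun x => inner ℂ (Gam φ x) (Gam f x)) 2 (torusVol k) := by
  obtain ⟨M, hM⟩ := hφ
  refine (memLp_gam f).of_le_mul (c := M)
    ((aestronglyMeasurable_gam φ).inner (aestronglyMeasurable_gam f)) ?_
  filter_upwards [hM] with x hx
  exact (norm_inner_le_norm _ _).trans (by gcongr)

theorem hasSum_inner_shift {φ ψ f w : L2 k}
    (hF : MemLp (fun x => inner ℂ (Gam φ x) (Gam f x)) 2 (torusVol k))
    (hH : MemLp (fun x => inner ℂ (Gam ψ x) (Gam w x)) 2 (torusVol k)) :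
    HasSum (fun l : Fin k → ℤ => star (inner ℂ (shift l φ) f) * inner ℂ (shift l ψ) w)
      (∫ x, star (inner ℂ (Gam φ x) (Gam f x)) * inner ℂ (Gam ψ x) (Gam w x) ∂(torusVol k)) := by
  simp only [inner_shift_eq_integral]
  exact hasSum_parseval hF hH

theorem hasSum_norm_inner_shift_sq {φ f : L2 k}
    (hF : MemLp (fun x => inner ℂ (Gam φ x) (Gam f x)) 2 (torusVol k)) :
    HasSum (fun l : Fin k → ℤ => ‖inner ℂ (shift l φ) f‖ ^ 2)
      (∫ x, ‖inner ℂ (Gam φ x) (Gam f x)‖ ^ 2 ∂(torusVol k)) := by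
  have h := hasSum_inner_shift hF hF
  have e : ∀ z : ℂ, star z * z = ((‖z‖ ^ 2 : ℝ) : ℂ) := fun z => by
    rw [Complex.star_def, Complex.conj_mul']; norm_cast
  simp only [e] at h
  rw [integral_complex_ofReal] at h
  exact_mod_cast h

theorem integral_norm_gam_sq (f : L2 k) :
    ∫ x, ‖Gam f x‖ ^ 2 ∂(torusVol k) = ‖f‖ ^ 2 := by
  have h := inner_eq_integral_gam f f
  simp only [inner_self_eq_norm_sq_to_K] at h
  have h' : ((‖f‖ ^ 2 : ℝ) : ℂ) = ∫ x, ((‖Gam f x‖ ^ 2 : ℝ) : ℂ) ∂(torusVol k) := by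
    simpa using h
  rw [integral_complex_ofReal] at h'
  exact_mod_cast h'.symm

/-- Testing the Bessel bound on the function with fiber `1_E Gam φ`, where `‖Gam φ‖² > b` on `E`,
gives `∫_E ‖Gam φ‖⁴ ≤ b ∫_E ‖Gam φ‖²`, which forces `E` to be null. -/
theorem essBdd_of_bessel {φ : L2 k} {b : ℝ} (hb0 : 0 < b) (hb : ∀ f : L2 k,
    Summable (fun l : Fin k → ℤ => ‖inner ℂ (shift l φ) f‖ ^ 2) ∧
      ∑' l : Fin k → ℤ, ‖inner ℂ (shift l φ) f‖ ^ 2 ≤ b * ‖f‖ ^ 2) : EssBdd φ := by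
  obtain ⟨u, hu, hφu⟩ := aestronglyMeasurable_gam φ
  have hun : Measurable fun x => ‖u x‖ := hu.norm.measurable
  -- The cutoff `‖u x‖ ≤ N` keeps the bracket square integrable, so that Parseval applies before
  -- boundedness is known.
  suffices h : ∀ N : ℕ, ∀ᵐ x ∂(torusVol k), ¬ (b < ‖u x‖ ^ 2 ∧ ‖u x‖ ≤ N) by
    refine ⟨Real.sqrt b, ?_⟩
    filter_upwards [ae_all_iff.2 h, hφu] with x hx hx'
    rw [hx']
    obtain ⟨N, hN⟩ := exists_nat_ge ‖u x‖
    exact Real.le_sqrt_of_sq_le (not_lt.1 fun hlt => hx N ⟨hlt, hN⟩)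
  intro N
  set E : Set (RSpace k) := {x | b < ‖u x‖ ^ 2 ∧ ‖u x‖ ≤ N} with hE
  have hEm : MeasurableSet E :=
    (measurableSet_lt measurable_const (hun.pow_const 2)).inter
      (measurableSet_le hun measurable_const)
  have hu2 : MemLp u 2 (torusVol k) := (memLp_gam φ).ae_eq hφu
  obtain ⟨f, hf⟩ := exists_gam_eq (hu2.indicator hEm)
  have hin : ∀ᵐ x ∂(torusVol k), inner ℂ (Gam φ x) (Gam f x) =
      ((E.indicator (fun x => ‖u x‖ ^ 2) x : ℝ) : ℂ) := by
    filter_upwards [hf, hφu] with x h1 h2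
    rw [h1, h2]
    by_cases hx : x ∈ E
    · simp only [Set.indicator_of_mem hx]
      rw [inner_self_eq_norm_sq_to_K]; norm_cast
    · simp [Set.indicator_of_notMem hx]
  have hbd : ∀ x, ‖E.indicator (fun x => ‖u x‖ ^ 2) x‖ ≤ (N : ℝ) ^ 2 := by
    intro x
    by_cases hx : x ∈ E
    · rw [Set.indicator_of_mem hx, Real.norm_of_nonneg (by positivity)]
      exact pow_le_pow_left₀ (norm_nonneg _) hx.2 2
    · rw [Set.indicator_of_notMem hx, norm_zero]; positivity
  have hmE : Measurable (E.indicator (fun x => ‖u x‖ ^ 2)) := (hun.pow_const 2).indicator hEm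
  have hF : MemLp (fun x => inner ℂ (Gam φ x) (Gam f x)) 2 (torusVol k) := by
    refine MemLp.of_bound ((aestronglyMeasurable_gam φ).inner (aestronglyMeasurable_gam f))
      ((N : ℝ) ^ 2) ?_
    filter_upwards [hin] with x hx
    rw [hx, Complex.norm_real]
    exact hbd x
  have h1 := (hb f).2
  rw [(hasSum_norm_inner_shift_sq hF).tsum_eq, ← integral_norm_gam_sq] at h1
  have e1 : ∫ x, ‖inner ℂ (Gam φ x) (Gam f x)‖ ^ 2 ∂(torusVol k) =
      ∫ x, (E.indicator (fun x => ‖u x‖ ^ 2) x) ^ 2 ∂(torusVol k) := by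
    refine integral_congr_ae ?_
    filter_upwards [hin] with x hx
    rw [hx, Complex.norm_real, Real.norm_eq_abs, sq_abs]
  have e2 : ∫ x, ‖Gam f x‖ ^ 2 ∂(torusVol k) =
      ∫ x, E.indicator (fun x => ‖u x‖ ^ 2) x ∂(torusVol k) := by
    refine integral_congr_ae ?_
    filter_upwards [hf] with x hx
    rw [hx]
    by_cases hxE : x ∈ E
    · simp [Set.indicator_of_mem hxE]
    · simp [Set.indicator_of_notMem hxE]
  rw [e1, e2, ← integral_const_mul, ← sub_nonneg, ← integral_sub] at h1
  rotate_left
  · exact (Integrable.of_bound hmE.aestronglyMeasurable _ (Eventually.of_forall hbd)).const_mul b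
  · refine Integrable.of_bound (C := ((N : ℝ) ^ 2) ^ 2) (hmE.pow_const 2).aestronglyMeasurable
      (Eventually.of_forall fun x => ?_)
    rw [norm_pow]
    exact pow_le_pow_left₀ (norm_nonneg _) (hbd x) 2
  have hneg : ∀ x, 0 ≤ (E.indicator (fun x => ‖u x‖ ^ 2) x) ^ 2 -
      b * E.indicator (fun x => ‖u x‖ ^ 2) x := by
    intro x
    by_cases hx : x ∈ E
    · rw [Set.indicator_of_mem hx]
      nlinarith [hx.1, sq_nonneg ‖u x‖]
    · simp [Set.indicator_of_notMem hx]
  have hint : Integrable (fun x => (E.indicator (fun x => ‖u x‖ ^ 2) x) ^ 2 -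
      b * E.indicator (fun x => ‖u x‖ ^ 2) x) (torusVol k) := by
    refine Integrable.sub ?_ ?_
    · refine Integrable.of_bound (C := ((N : ℝ) ^ 2) ^ 2) (hmE.pow_const 2).aestronglyMeasurable
        (Eventually.of_forall fun x => ?_)
      rw [norm_pow]
      exact pow_le_pow_left₀ (norm_nonneg _) (hbd x) 2
    · exact (Integrable.of_bound hmE.aestronglyMeasurable _ (Eventually.of_forall hbd)).const_mul b
  have hz : ∫ x, ((E.indicator (fun x => ‖u x‖ ^ 2) x) ^ 2 -
      b * E.indicator (fun x => ‖u x‖ ^ 2) x) ∂(torusVol k) = 0 := by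
    refine le_antisymm ?_ (integral_nonneg hneg)
    have : ∀ x, (E.indicator (fun x => ‖u x‖ ^ 2) x) ^ 2 -
      b * E.indicator (fun x => ‖u x‖ ^ 2) x = -(b * E.indicator (fun x => ‖u x‖ ^ 2) x -
        (E.indicator (fun x => ‖u x‖ ^ 2) x) ^ 2) := fun x => by ring
    simp only [this]
    rw [integral_neg]
    linarith
  rw [integral_eq_zero_iff_of_nonneg hneg hint] at hz
  filter_upwards [hz] with x hx hxE
  have hxE' : x ∈ E := hxE
  simp only [Set.indicator_of_mem hxE', Pi.zero_apply] at hx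
  have : ‖u x‖ ^ 2 = 0 ∨ ‖u x‖ ^ 2 = b := by
    have : ‖u x‖ ^ 2 * (‖u x‖ ^ 2 - b) = 0 := by linarith
    rcases mul_eq_zero.1 this with h | h
    · exact Or.inl h
    · exact Or.inr (by linarith)
  rcases this with h | h <;> linarith [hxE'.1]

theorem hasSum_prod_fin {ι E : Type*} [AddCommMonoid E] [TopologicalSpace E] [ContinuousAdd E]
    {F : ι × Fin n → E} {a : Fin n → E} (h : ∀ i, HasSum (fun l => F (l, i)) (a i)) :
    HasSum F (∑ i, a i) := by
  classical
  have h1 : ∀ i, HasSum (fun p : ι × Fin n => if p.2 = i then F p else 0) (a i) := by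
    intro i
    rw [← (Prod.mk_left_injective i).hasSum_iff]
    · simpa [Function.comp_def] using h i
    · rintro ⟨l, j⟩ hp
      have : j ≠ i := fun e => hp ⟨l, by rw [e]⟩
      simp [this]
  have h2 := hasSum_sum (s := Finset.univ) fun i _ => h1 i
  simpa using h2

theorem isBessel_translates {φ : Fin n → L2 k} (h : ∀ i, EssBdd (φ i)) :
    IsBessel (translates φ) := by
  choose M hM using h
  -- The summand `1` only ensures that the Bessel constant is positive.
  refine ⟨1 + ∑ i, (M i) ^ 2, by positivity, fun f => ?_⟩
  have hs : ∀ i, HasSum (fun l : Fin k → ℤ => ‖inner ℂ (shift l (φ i)) f‖ ^ 2)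
      (∫ x, ‖inner ℂ (Gam (φ i) x) (Gam f x)‖ ^ 2 ∂(torusVol k)) := fun i =>
    hasSum_norm_inner_shift_sq (EssBdd.memLp_inner ⟨M i, hM i⟩ f)
  have h1 := hasSum_prod_fin (F := fun p => ‖inner ℂ (shift p.1 (φ p.2)) f‖ ^ 2) hs
  simp only [translates]
  refine ⟨h1.summable, ?_⟩
  rw [h1.tsum_eq]
  have h2 : ∀ i, ∫ x, ‖inner ℂ (Gam (φ i) x) (Gam f x)‖ ^ 2 ∂(torusVol k) ≤
      (M i) ^ 2 * ‖f‖ ^ 2 := by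
    intro i
    rw [← integral_norm_gam_sq, ← integral_const_mul]
    refine integral_mono_ae (EssBdd.memLp_inner ⟨M i, hM i⟩ f).integrable_norm_pow'
      ((memLp_gam f).integrable_norm_pow'.const_mul _) ?_
    filter_upwards [hM i] with x hx
    rw [← mul_pow]
    exact pow_le_pow_left₀ (norm_nonneg _) ((norm_inner_le_norm _ _).trans (by gcongr)) 2
  calc _ ≤ ∑ i, (M i) ^ 2 * ‖f‖ ^ 2 := Finset.sum_le_sum fun i _ => h2 i
    _ ≤ _ := by rw [← Finset.sum_mul]; gcongr; linarith

theorem IsBessel.essBdd {φ : Fin n → L2 k} (h : IsBessel (translates φ)) (i : Fin n) :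
    EssBdd (φ i) := by
  obtain ⟨b, hb, h⟩ := h
  refine essBdd_of_bessel hb fun f => ?_
  have hinj : Function.Injective fun l : Fin k → ℤ => (l, i) := Prod.mk_left_injective i
  have hs := (h f).1.comp_injective hinj
  refine ⟨hs, le_trans ?_ (h f).2⟩
  exact hs.tsum_le_tsum_of_inj _ hinj (fun _ _ => by positivity) (fun _ => le_rfl) (h f).1

/-! ### Mixed frame operators -/

/-- The operator `f ↦ ∑ p, ⟨F p, f⟩ G p`. -/
def mixedFrameOp {ι H : Type*} [NormedAddCommGroup H] [InnerProductSpace ℂ H] [CompleteSpace H]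
    (F G : ι → H) (hF : IsBessel F) (hG : IsBessel G) : H →L[ℂ] H :=
  (ContinuousLinearMap.adjoint (analysisOp G hG)).comp (analysisOp F hF)

theorem frameOp_eq_mixedFrameOp {ι H : Type*} [NormedAddCommGroup H] [InnerProductSpace ℂ H]
    [CompleteSpace H] (F : ι → H) (hF : IsBessel F) : frameOp F = mixedFrameOp F F hF hF :=
  dif_pos hF

theorem hasSum_inner_mixedFrameOp {ι H : Type*} [NormedAddCommGroup H] [InnerProductSpace ℂ H]
    [CompleteSpace H] (F G : ι → H) (hF : IsBessel F) (hG : IsBessel G) (w f : H) :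
    HasSum (fun p => star (inner ℂ (G p) w) * inner ℂ (F p) f)
      (inner ℂ w (mixedFrameOp F G hF hG f)) := by
  rw [mixedFrameOp, ContinuousLinearMap.comp_apply, ContinuousLinearMap.adjoint_inner_right]
  have h := lp.hasSum_inner (𝕜 := ℂ) (analysisOp G hG w) (analysisOp F hF f)
  refine h.congr_fun fun p => ?_
  change _ = inner ℂ (inner ℂ (G p) w) (inner ℂ (F p) f)
  rw [RCLike.inner_apply, mul_comm]; rfl

/-- The finite rank operator `w ↦ ∑ i, ⟨a i, w⟩ b i`. -/
def rankSum {H : Type*} [NormedAddCommGroup H] [InnerProductSpace ℂ H] (a b : Fin n → H) :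
    H →L[ℂ] H := ∑ i, (innerSL ℂ (a i)).smulRight (b i)

theorem rankSum_apply {H : Type*} [NormedAddCommGroup H] [InnerProductSpace ℂ H]
    (a b : Fin n → H) (w : H) : rankSum a b w = ∑ i, inner ℂ (a i) w • b i := by
  simp [rankSum]

theorem norm_rankSum_le {H : Type*} [NormedAddCommGroup H] [InnerProductSpace ℂ H]
    (a b : Fin n → H) : ‖rankSum a b‖ ≤ ∑ i, ‖a i‖ * ‖b i‖ := by
  refine (norm_sum_le _ _).trans (Finset.sum_le_sum fun i _ => ?_)
  rw [ContinuousLinearMap.norm_smulRight_apply, innerSL_apply_norm]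

theorem memLp_rankSum_gam {φ ψ : Fin n → L2 k} (hφ : ∀ i, EssBdd (φ i)) (hψ : ∀ i, EssBdd (ψ i))
    (f : L2 k) : MemLp (fun x => rankSum (fun i => Gam (φ i) x) (fun i => Gam (ψ i) x) (Gam f x))
      2 (torusVol k) := by
  simp only [rankSum_apply]
  refine memLp_finsetSum _ fun i _ => ?_
  obtain ⟨M, hM⟩ := hψ i
  refine ((hφ i).memLp_inner f).of_le_mul (c := M)
    (((hφ i).memLp_inner f).1.smul (aestronglyMeasurable_gam (ψ i))) ?_
  filter_upwards [hM] with x hx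
  rw [norm_smul, mul_comm]
  gcongr

/-- By Parseval, pairing the operator with any `w` equals pairing `Gam w` with the fiberwise finite
sum. That sum is square integrable because Bessel families have bounded fibers, so it is itself the
fiber of some `u`, and `u` must be the image of `f`. -/
theorem gam_mixedFrameOp {φ ψ : Fin n → L2 k} (hφ : IsBessel (translates φ))
    (hψ : IsBessel (translates ψ)) (f : L2 k) :
    ∀ᵐ x ∂(torusVol k), Gam (mixedFrameOp (translates φ) (translates ψ) hφ hψ f) x =
      rankSum (fun i => Gam (φ i) x) (fun i => Gam (ψ i) x) (Gam f x) := by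
  obtain ⟨u, hu⟩ := exists_gam_eq (memLp_rankSum_gam hφ.essBdd hψ.essBdd f)
  suffices h : mixedFrameOp (translates φ) (translates ψ) hφ hψ f = u by rw [h]; exact hu
  refine ext_inner_left ℂ fun w => ?_
  have hs : ∀ i, HasSum (fun l : Fin k → ℤ => star (inner ℂ (shift l (ψ i)) w) *
      inner ℂ (shift l (φ i)) f) (∫ x, star (inner ℂ (Gam (ψ i) x) (Gam w x)) *
        inner ℂ (Gam (φ i) x) (Gam f x) ∂(torusVol k)) := fun i =>
    hasSum_inner_shift ((hψ.essBdd i).memLp_inner w) ((hφ.essBdd i).memLp_inner f)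
  have h1 := hasSum_prod_fin (F := fun p => star (inner ℂ (shift p.1 (ψ p.2)) w) *
    inner ℂ (shift p.1 (φ p.2)) f) hs
  have h2 : HasSum (fun p : (Fin k → ℤ) × Fin n => star (inner ℂ (shift p.1 (ψ p.2)) w) *
      inner ℂ (shift p.1 (φ p.2)) f)
        (inner ℂ w (mixedFrameOp (translates φ) (translates ψ) hφ hψ f)) :=
    (hasSum_inner_mixedFrameOp _ _ hφ hψ w f).congr_fun fun p => by simp only [translates]
  rw [h2.unique h1, inner_eq_integral_gam,
    ← integral_finsetSum]
  · refine integral_congr_ae ?_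
    filter_upwards [hu] with x hx
    rw [hx, rankSum_apply, inner_sum]
    refine Finset.sum_congr rfl fun i _ => ?_
    rw [inner_smul_right, mul_comm, ← inner_conj_symm (Gam w x)]; rfl
  · intro i _
    exact ((hψ.essBdd i).memLp_inner w).star.integrable_mul ((hφ.essBdd i).memLp_inner f)

/-! ### Fiber fields -/

theorem exists_gam_eq_const (ξ : Seq2 k) : ∃ f : L2 k, ∀ᵐ x ∂(torusVol k), Gam f x = ξ :=
  exists_gam_eq (memLp_const ξ)

/-- Countably many functions, with constant fibers the coordinate vectors of `ℓ²`, determine a field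
outside a single null set. -/
theorem IsFiberField.ae_eq {S : L2 k →L[ℂ] L2 k} {s s' : RSpace k → (Seq2 k →L[ℂ] Seq2 k)}
    (h : IsFiberField S s) (h' : IsFiberField S s') : ∀ᵐ x ∂(torusVol k), s x = s' x := by
  classical
  choose f hf using fun l : Fin k → ℤ => exists_gam_eq_const (lp.single 2 l (1 : ℂ) : Seq2 k)
  filter_upwards [ae_all_iff.2 hf, ae_all_iff.2 fun l => h.2.2 (f l),
    ae_all_iff.2 fun l => h'.2.2 (f l)] with x h1 h2 h3
  refine lp.ext_continuousLinearMap (p := 2) (by norm_num) fun l => ?_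
  ext1
  have := (h2 l).trans (h3 l).symm
  rw [h1] at this
  exact this

/-- `fiber` is an arbitrary choice, with default `0`; statements about it are proved by exhibiting
an explicit field and transferring. -/
theorem IsFiberField.fiber_ae_eq {S : L2 k →L[ℂ] L2 k} {s : RSpace k → (Seq2 k →L[ℂ] Seq2 k)}
    (h : IsFiberField S s) : ∀ᵐ x ∂(torusVol k), fiber S x = s x := by
  have hex : ∃ s, IsFiberField S s := ⟨s, h⟩
  rw [fiber, dif_pos hex]
  exact hex.choose_spec.ae_eq h

theorem IsFiberField.add {S S' : L2 k →L[ℂ] L2 k} {s s' : RSpace k → (Seq2 k →L[ℂ] Seq2 k)}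
    (h : IsFiberField S s) (h' : IsFiberField S' s') :
    IsFiberField (S + S') (fun x => s x + s' x) := by
  obtain ⟨h1, ⟨M, hM⟩, h3⟩ := h
  obtain ⟨h1', ⟨M', hM'⟩, h3'⟩ := h'
  refine ⟨fun ξ η => ?_, ⟨M + M', ?_⟩, fun f => ?_⟩
  · simp only [add_apply, inner_add_right]
    exact (h1 ξ η).add (h1' ξ η)
  · filter_upwards [hM, hM'] with x hx hx'
    exact (norm_add_le _ _).trans (add_le_add hx hx')
  · filter_upwards [h3 f, h3' f, gam_add (S f) (S' f)] with x hx hx' ha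
    rw [add_apply, add_apply, ha, hx, hx']

theorem isFiberField_mixedFrameOp {φ ψ : Fin n → L2 k} (hφ : IsBessel (translates φ))
    (hψ : IsBessel (translates ψ)) :
    IsFiberField (mixedFrameOp (translates φ) (translates ψ) hφ hψ)
      (fun x => rankSum (fun i => Gam (φ i) x) (fun i => Gam (ψ i) x)) := by
  refine ⟨fun ξ η => ?_, ?_, fun f => ?_⟩
  · simp only [rankSum_apply, inner_sum, inner_smul_right]
    refine Finset.aemeasurable_fun_sum _ fun i _ => ?_
    exact ((aestronglyMeasurable_gam (φ i)).inner aestronglyMeasurable_const).aemeasurable.mul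
      (aestronglyMeasurable_const.inner (aestronglyMeasurable_gam (ψ i))).aemeasurable
  · choose M hM using hφ.essBdd
    choose M' hM' using hψ.essBdd
    refine ⟨∑ i, M i * M' i, ?_⟩
    filter_upwards [ae_all_iff.2 hM, ae_all_iff.2 hM'] with x hx hx'
    refine (norm_rankSum_le _ _).trans (Finset.sum_le_sum fun i _ => ?_)
    exact mul_le_mul (hx i) (hx' i) (norm_nonneg _) ((norm_nonneg _).trans (hx i))
  · filter_upwards [gam_mixedFrameOp hφ hψ f] with x hx using hx.symm

theorem isFiberField_frameOp {φ : Fin n → L2 k} (hφ : IsBessel (translates φ)) :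
    IsFiberField (frameOp (translates φ))
      (fun x => rankSum (fun i => Gam (φ i) x) (fun i => Gam (φ i) x)) := by
  rw [frameOp_eq_mixedFrameOp _ hφ]
  exact isFiberField_mixedFrameOp hφ hφ

end

section

/-! ### Frame operators of frames for closed subspaces -/

section FrameOperator

/-- The family lies in `W`, so `f` may be replaced by its projection onto `W`, where the upper frame
bound holds. -/
theorem IsFrameFor.isBessel {ι H : Type*} [NormedAddCommGroup H] [InnerProductSpace ℂ H]
    {F : ι → H} {W : Submodule ℂ H} [W.HasOrthogonalProjection] (h : IsFrameFor F W) : IsBessel F := by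
  obtain ⟨hm, a, b, ha, hab, h⟩ := h
  refine ⟨b, ha.trans_le hab, fun f => ?_⟩
  have e : ∀ i, inner ℂ (F i) f = inner ℂ (F i) (W.starProjection f) := fun i => by
    rw [← sub_eq_zero, ← inner_sub_right]
    exact Submodule.sub_starProjection_mem_orthogonal f _ (hm i)
  simp only [e]
  obtain ⟨h1, -, h3⟩ := h _ (W.starProjection_apply_mem f)
  refine ⟨h1, h3.trans ?_⟩
  have := W.norm_starProjection_apply_le f
  have hb : 0 ≤ b := (ha.trans_le hab).le
  gcongr

variable {ι H : Type*} [NormedAddCommGroup H] [InnerProductSpace ℂ H] [CompleteSpace H]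
  {F : ι → H}

theorem hasSum_norm_inner_frameOp (hF : IsBessel F) (f : H) :
    HasSum (fun p => ((‖inner ℂ (F p) f‖ ^ 2 : ℝ) : ℂ)) (inner ℂ f (frameOp F f)) := by
  rw [frameOp_eq_mixedFrameOp F hF]
  refine (hasSum_inner_mixedFrameOp F F hF hF f f).congr_fun fun p => ?_
  rw [Complex.star_def, Complex.conj_mul']
  norm_cast

theorem frameOp_isPositive (F : ι → H) : (frameOp F).IsPositive := by
  by_cases hF : IsBessel F
  · rw [frameOp_eq_mixedFrameOp F hF]
    exact ContinuousLinearMap.isPositive_adjoint_comp_self _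
  · rw [frameOp, dif_neg hF]
    exact ContinuousLinearMap.isPositive_zero

theorem frameOp_eq_zero_of_mem_orthogonal {W : Submodule ℂ H} (hF : IsBessel F) (h : ∀ i, F i ∈ W) {w : H}
    (hw : w ∈ Wᗮ) : frameOp F w = 0 := by
  refine ext_inner_left ℂ fun u => ?_
  rw [frameOp_eq_mixedFrameOp F hF, inner_zero_right]
  have h1 := hasSum_inner_mixedFrameOp F F hF hF u w
  have : ∀ p, inner ℂ (F p) w = 0 := fun p => hw _ (h p)
  simp only [this, mul_zero] at h1
  exact h1.unique hasSum_zero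

variable {W : Submodule ℂ H} [W.HasOrthogonalProjection]

theorem mixedFrameOp_mem {G : ι → H} (hF : IsBessel F) (hG : IsBessel G) (h : ∀ i, G i ∈ W)
    (f : H) : mixedFrameOp F G hF hG f ∈ W := by
  rw [← W.orthogonal_orthogonal]
  refine (Submodule.mem_orthogonal _ _).2 fun w hw => ?_
  have h1 := hasSum_inner_mixedFrameOp F G hF hG w f
  have : ∀ p, inner ℂ (G p) w = 0 := fun p => hw _ (h p)
  simp only [this, star_zero, zero_mul] at h1
  exact h1.unique hasSum_zero

theorem frameOp_mem (hF : IsBessel F) (h : ∀ i, F i ∈ W) (f : H) : frameOp F f ∈ W := by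
  rw [frameOp_eq_mixedFrameOp F hF]
  exact mixedFrameOp_mem hF hF h f

theorem frameOp_starProjection (hF : IsBessel F) (h : ∀ i, F i ∈ W) (f : H) :
    frameOp F (W.starProjection f) = frameOp F f := by
  rw [eq_comm, ← sub_eq_zero, ← map_sub]
  exact frameOp_eq_zero_of_mem_orthogonal hF h (Submodule.sub_starProjection_mem_orthogonal f)

theorem IsBessel.map (hF : IsBessel F) (L : H →L[ℂ] H) : IsBessel fun i => L (F i) := by
  obtain ⟨b, hb, h⟩ := hF
  refine ⟨b * (‖ContinuousLinearMap.adjoint L‖ + 1) ^ 2, by positivity, fun f => ?_⟩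
  simp only [← ContinuousLinearMap.adjoint_inner_right]
  refine ⟨(h _).1, (h _).2.trans ?_⟩
  rw [mul_assoc, ← mul_pow]
  gcongr
  refine (ContinuousLinearMap.le_opNorm _ _).trans ?_
  gcongr
  linarith

theorem mixedFrameOp_map (hF : IsBessel F) (L : H →L[ℂ] H) (f : H) :
    mixedFrameOp F (fun i => L (F i)) hF (hF.map L) f = L (frameOp F f) := by
  refine ext_inner_left ℂ fun w => ?_
  have h1 := hasSum_inner_mixedFrameOp F _ hF (hF.map L) w f
  have h2 := hasSum_inner_mixedFrameOp F F hF hF (ContinuousLinearMap.adjoint L w) f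
  rw [← frameOp_eq_mixedFrameOp, ContinuousLinearMap.adjoint_inner_left] at h2
  simp only [ContinuousLinearMap.adjoint_inner_right] at h2
  exact h1.unique h2

/-- The frame operator of a frame for `W`, completed by the identity on `Wᗮ`. -/
def extendedFrameOp (F : ι → H) (W : Submodule ℂ H) [W.HasOrthogonalProjection] : H →L[ℂ] H :=
  frameOp F + (ContinuousLinearMap.id ℂ H - W.starProjection)

theorem extendedFrameOp_apply (f : H) :
    extendedFrameOp F W f = frameOp F f + (f - W.starProjection f) := rfl

/-- The lower frame bound `a` on `W` and the identity on `Wᗮ` make the quadratic form coercive with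
constant `min a 1`. -/
theorem isUnit_extendedFrameOp (h : IsFrameFor F W) : IsUnit (extendedFrameOp F W) := by
  have hB := h.isBessel
  obtain ⟨hm, a, b, ha, hab, h⟩ := h
  refine ContinuousLinearMap.isUnit_of_forall_le_norm_inner_map _
    (c := (min a 1).toNNReal) (Real.toNNReal_pos.2 (lt_min ha one_pos)) fun x => ?_
  rw [Real.coe_toNNReal _ (le_min ha.le one_pos.le)]
  set p := W.starProjection x with hp
  have hpW : p ∈ W := W.starProjection_apply_mem x
  have hxp : x - p ∈ Wᗮ := Submodule.sub_starProjection_mem_orthogonal x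
  obtain ⟨h1, h2, -⟩ := h p hpW
  have e1 : inner ℂ x (extendedFrameOp F W x) =
      inner ℂ p (frameOp F p) + ((‖x - p‖ ^ 2 : ℝ) : ℂ) := by
    rw [extendedFrameOp_apply, ← hp, inner_add_right, ← frameOp_starProjection hB hm x, ← hp]
    have hxs : x = p + (x - p) := by abel
    congr 1
    · conv_lhs => rw [hxs]
      rw [inner_add_left, add_eq_left, ← inner_conj_symm, hxp _ (frameOp_mem hB hm p), map_zero]
    · conv_lhs => rw [hxs, add_sub_cancel_left]
      rw [inner_add_left, hxp _ hpW, zero_add, inner_self_eq_norm_sq_to_K]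
      norm_cast
  have e2 : inner ℂ p (frameOp F p) = ((∑' i, ‖inner ℂ (F i) p‖ ^ 2 : ℝ) : ℂ) :=
    (hasSum_norm_inner_frameOp hB p).unique (by exact_mod_cast h1.hasSum)
  have e3 : ‖x‖ ^ 2 = ‖p‖ ^ 2 + ‖x - p‖ ^ 2 := by
    have := norm_add_sq_eq_norm_sq_add_norm_sq_of_inner_eq_zero p (x - p) (𝕜 := ℂ) (hxp _ hpW)
    rw [add_sub_cancel] at this
    simpa [sq] using this
  rw [← inner_conj_symm, RCLike.norm_conj, e1, e2, ← Complex.ofReal_add, Complex.norm_real, e3]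
  refine le_trans ?_ (le_abs_self _)
  have l1 : ‖p‖ ^ 2 * min a 1 ≤ ‖p‖ ^ 2 * a := by gcongr; exact min_le_left _ _
  have l2 : ‖x - p‖ ^ 2 * min a 1 ≤ ‖x - p‖ ^ 2 * 1 := by gcongr; exact min_le_right _ _
  linarith

/-- The frame operator is invertible on `W`: there is an operator `R` which commutes with
everything that commutes with the frame operator and the projection onto `W`. -/
theorem exists_inverse_frameOp (h : IsFrameFor F W) : ∃ R : H →L[ℂ] H,
    (∀ f, R (frameOp F f) = W.starProjection f) ∧ (∀ f ∈ W, frameOp F (R f) = f) ∧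
      ∀ T : H →ₗ[ℂ] H, (∀ f, frameOp F (T f) = T (frameOp F f)) →
        (∀ f, W.starProjection (T f) = T (W.starProjection f)) → ∀ f, R (T f) = T (R f) := by
  have hB := h.isBessel
  obtain ⟨A, hA⟩ := isUnit_extendedFrameOp h
  have hR1 : ∀ f, (↑A⁻¹ : H →L[ℂ] H) (extendedFrameOp F W f) = f := fun f => by
    rw [← hA]
    exact congrArg (fun L : H →L[ℂ] H => L f) A.inv_mul
  have hR2 : ∀ f, extendedFrameOp F W ((↑A⁻¹ : H →L[ℂ] H) f) = f := fun f => by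
    rw [← hA]
    exact congrArg (fun L : H →L[ℂ] H => L f) A.mul_inv
  refine ⟨(↑A⁻¹ : H →L[ℂ] H), fun f => ?_, fun f hf => ?_, fun T h1 h2 f => ?_⟩
  · have : frameOp F f = extendedFrameOp F W (W.starProjection f) := by
      rw [extendedFrameOp_apply, frameOp_starProjection hB h.1,
        Submodule.starProjection_eq_self_iff.2 (W.starProjection_apply_mem f), sub_self, add_zero]
    rw [this, hR1]
  · set u := (↑A⁻¹ : H →L[ℂ] H) f
    have hu : frameOp F u + (u - W.starProjection u) = f := hR2 f
    have h3 : u - W.starProjection u ∈ W := by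
      rw [eq_sub_of_add_eq' hu]
      exact W.sub_mem hf (frameOp_mem hB h.1 u)
    have h4 : u - W.starProjection u = 0 :=
      inner_self_eq_zero.1 (Submodule.sub_starProjection_mem_orthogonal u _ h3)
    rw [h4, add_zero] at hu
    exact hu
  · have h3 : extendedFrameOp F W (T ((↑A⁻¹ : H →L[ℂ] H) f)) = T f := by
      rw [extendedFrameOp_apply, h1, h2, ← map_sub, ← map_add, ← extendedFrameOp_apply, hR2]
    rw [← h3, hR1]

end FrameOperator

variable {k n : ℕ}

theorem shift_shift_neg (l : Fin k → ℤ) (f : L2 k) : shift l (shift (-l) f) = f := by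
  refine eq_of_gam_ae_eq ?_
  filter_upwards [gam_shift l (shift (-l) f), gam_shift (-l) f] with x h1 h2
  have : chi (-l) x * chi l x = 1 := by
    rw [chi_neg, Complex.star_def, Complex.conj_mul', norm_chi]; norm_num
  rw [h1, h2, smul_smul, neg_neg, this, one_smul]

theorem starProjection_shift {V : Submodule ℂ (L2 k)} [V.HasOrthogonalProjection]
    (hV : IsShiftInvariant V) (l : Fin k → ℤ) (f : L2 k) :
    V.starProjection (shift l f) = shift l (V.starProjection f) := by
  refine Submodule.eq_starProjection_of_mem_of_inner_eq_zero
    (hV.2 l _ (V.starProjection_apply_mem f)) fun w hw => ?_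
  rw [← shift_shift_neg l w, ← map_sub, LinearIsometry.inner_map_map]
  exact Submodule.starProjection_inner_eq_zero f _ (hV.2 _ _ hw)

theorem mixedFrameOp_shift {φ ψ : Fin n → L2 k} (hφ : IsBessel (translates φ))
    (hψ : IsBessel (translates ψ)) :
    IsShiftPreserving (mixedFrameOp (translates φ) (translates ψ) hφ hψ) := by
  intro l f
  refine eq_of_gam_ae_eq ?_
  filter_upwards [gam_mixedFrameOp hφ hψ (shift l f), gam_mixedFrameOp hφ hψ f, gam_shift l f,
    gam_shift l (mixedFrameOp (translates φ) (translates ψ) hφ hψ f)] with x h1 h2 h3 h4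
  rw [h1, h3, h4, h2, map_smul]

theorem frameOp_shift {φ : Fin n → L2 k} (hφ : IsBessel (translates φ)) :
    IsShiftPreserving (frameOp (translates φ)) := by
  rw [frameOp_eq_mixedFrameOp _ hφ]
  exact mixedFrameOp_shift hφ hφ

/-! ### The range function -/

section Range

variable {V : Submodule ℂ (L2 k)} {g : Fin n → L2 k}

theorem mem_of_translates (hg : IsFrameFor (translates g) V) (i : Fin n) : g i ∈ V := by
  have h0 : shift (0 : Fin k → ℤ) (g i) = g i := by
    refine eq_of_gam_ae_eq ?_
    filter_upwards [gam_shift 0 (g i)] with x hx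
    rw [hx, neg_zero]
    simp [chi, UnitAddTorus.mFourier_zero]
  have := hg.1 (0, i)
  rwa [translates, h0] at this

/-- On `V` one has `f = S (R f)` with `R` inverting the frame operator `S`, and the fibers of `S`
take values in this span. -/
theorem gam_mem_span (hV : IsShiftInvariant V) (hg : IsFrameFor (translates g) V) {f : L2 k}
    (hf : f ∈ V) :
    ∀ᵐ x ∂(torusVol k), Gam f x ∈ Submodule.span ℂ (Set.range fun i => Gam (g i) x) := by
  have := hV.1.completeSpace_coe
  obtain ⟨R, -, hR, -⟩ := exists_inverse_frameOp hg
  filter_upwards [(isFiberField_frameOp hg.isBessel).2.2 (R f)] with x hx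
  rw [hR f hf] at hx
  rw [← hx, rankSum_apply]
  exact Submodule.sum_mem _ fun i _ => Submodule.smul_mem _ _ (Submodule.subset_span ⟨i, rfl⟩)

/-- Orthogonality to `V` is fiberwise: if `w ∈ Vᗮ`, all Fourier coefficients of the bracket of `g i`
and `w` vanish, hence so does the bracket. Thus `f` is orthogonal to `Vᗮ`, and `V` is closed. -/
theorem mem_of_gam_mem_span (hV : IsShiftInvariant V) (hg : IsFrameFor (translates g) V) {f : L2 k}
    (hf : ∀ᵐ x ∂(torusVol k), Gam f x ∈ Submodule.span ℂ (Set.range fun i => Gam (g i) x)) :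
    f ∈ V := by
  have := hV.1.completeSpace_coe
  rw [← V.orthogonal_orthogonal]
  refine (Submodule.mem_orthogonal _ _).2 fun w hw => ?_
  have h1 : ∀ i, ∀ᵐ x ∂(torusVol k), inner ℂ (Gam (g i) x) (Gam w x) = 0 := by
    intro i
    have hm := (hg.isBessel.essBdd i).memLp_inner w
    have hs := hasSum_norm_inner_shift_sq hm
    have : ∀ l : Fin k → ℤ, inner ℂ (shift l (g i)) w = 0 := fun l => hw _ (hg.1 (l, i))
    simp only [this, norm_zero, ne_eq, OfNat.ofNat_ne_zero, not_false_eq_true, zero_pow] at hs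
    have h0 := hs.unique hasSum_zero
    rw [integral_eq_zero_iff_of_nonneg (fun x => by positivity) hm.integrable_norm_pow'] at h0
    filter_upwards [h0] with x hx
    simpa using hx
  rw [inner_eq_integral_gam]
  refine integral_eq_zero_of_ae ?_
  filter_upwards [hf, ae_all_iff.2 h1] with x hx h2
  have hle : Submodule.span ℂ (Set.range fun i => Gam (g i) x) ≤ (ℂ ∙ Gam w x)ᗮ := by
    rw [Submodule.span_le]
    rintro _ ⟨i, rfl⟩
    exact Submodule.mem_orthogonal_singleton_iff_inner_left.2 (h2 i)
  exact Submodule.mem_orthogonal_singleton_iff_inner_right.1 (hle hx)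

/-- One inclusion is `gam_mem_span` along the dense sequence, the span being closed as it is
finite-dimensional. For the other, members of the dense sequence approximate `g i` in norm, and
along a subsequence their fibers converge almost everywhere. -/
theorem rangeFn_eq_span (hV : IsShiftInvariant V) (hg : IsFrameFor (translates g) V) :
    ∀ᵐ x ∂(torusVol k), rangeFn V x = Submodule.span ℂ (Set.range fun i => Gam (g i) x) := by
  have h1 : ∀ᵐ x ∂(torusVol k), ∀ j : ℕ, Gam ((TopologicalSpace.denseSeq V j : V) : L2 k) x ∈
      Submodule.span ℂ (Set.range fun i => Gam (g i) x) :=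
    ae_all_iff.2 fun j => gam_mem_span hV hg (TopologicalSpace.denseSeq V j).2
  have h2 : ∀ i, ∀ᵐ x ∂(torusVol k), Gam (g i) x ∈
      closure (Set.range fun j : ℕ => Gam ((TopologicalSpace.denseSeq V j : V) : L2 k) x) := by
    intro i
    have hd := (TopologicalSpace.denseRange_denseSeq V) ⟨g i, mem_of_translates hg i⟩
    obtain ⟨u, hu, hlim⟩ := mem_closure_iff_seq_limit.1 hd
    choose m hm using hu
    have hlim' : Tendsto (fun j => gamLp k (u j : L2 k)) atTop (nhds (gamLp k (g i))) :=
      ((gamLp k).continuous.tendsto (g i)).comp ((continuous_subtype_val.tendsto _).comp hlim)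
    obtain ⟨ns, -, hns⟩ := (tendstoInMeasure_of_tendsto_Lp hlim').exists_seq_tendsto_ae
    filter_upwards [hns, coeFn_gamLp (g i), ae_all_iff.2 fun j => coeFn_gamLp (u j : L2 k)]
      with x h3 h4 h5
    rw [h4] at h3
    refine mem_closure_of_tendsto h3 (Eventually.of_forall fun j => ⟨m (ns j), ?_⟩)
    simp only [h5, hm]
  filter_upwards [h1, ae_all_iff.2 h2] with x hx1 hx2
  have hfin := FiniteDimensional.span_of_finite ℂ (Set.finite_range fun i => Gam (g i) x)
  refine le_antisymm ?_ ?_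
  · refine Submodule.topologicalClosure_minimal _ ?_ (Submodule.closed_of_finiteDimensional _)
    rw [Submodule.span_le]
    rintro _ ⟨j, rfl⟩
    exact hx1 j
  · rw [Submodule.span_le]
    rintro _ ⟨i, rfl⟩
    exact closure_mono Submodule.subset_span (hx2 i)

/-- A bounded shift-preserving operator which vanishes on the orthogonal complement of `V` has a
field of fibers of finite rank. -/
theorem exists_rankSum_isFiberField (hV : IsShiftInvariant V) (hg : IsFrameFor (translates g) V)
    {B : L2 k →L[ℂ] L2 k} (hB : IsShiftPreserving B) (hBV : ∀ f, B f ∈ V)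
    (hB0 : ∀ w ∈ Vᗮ, B w = 0) :
    ∃ ψ : Fin n → L2 k, (∀ i, ψ i ∈ V) ∧
      IsFiberField B (fun x => rankSum (fun i => Gam (g i) x) (fun i => Gam (ψ i) x)) := by
  have := hV.1.completeSpace_coe
  obtain ⟨R, hR, -, hRc⟩ := exists_inverse_frameOp hg
  -- Since `R` commutes with translations, `B R` maps the frame to another family of translates.
  have hRs : ∀ l f, R (shift l f) = shift l (R f) := fun l =>
    hRc (shift l).toLinearMap (fun f => frameOp_shift hg.isBessel l f)
      (fun f => starProjection_shift hV l f)
  have hmap : (fun p => (B.comp R) (translates g p)) = translates fun i => B (R (g i)) := by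
    funext p
    rw [translates, translates, ContinuousLinearMap.comp_apply, hRs, hB]
  have hψ : IsBessel (translates fun i => B (R (g i))) := by
    rw [← hmap]; exact hg.isBessel.map (B.comp R)
  refine ⟨fun i => B (R (g i)), fun i => hBV _, ?_⟩
  -- With `P` the projection onto `V`, `B f = B (P f) = (B R) (S f)`; expanding `S f` over the frame
  -- exhibits `B` as a mixed frame operator.
  have e : B = mixedFrameOp (translates g) (translates fun i => B (R (g i))) hg.isBessel hψ := by
    ext1 f
    have h1 := mixedFrameOp_map hg.isBessel (B.comp R) f
    have h2 : B (V.starProjection f) = B f := by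
      rw [eq_comm, ← sub_eq_zero, ← map_sub]
      exact hB0 _ (Submodule.sub_starProjection_mem_orthogonal f)
    rw [ContinuousLinearMap.comp_apply, hR, h2] at h1
    rw [← h1]
    simp only [hmap]
  have hf := isFiberField_mixedFrameOp hg.isBessel hψ
  rw [← e] at hf
  exact hf

end Range

/-! ### Positive operators have positive fibers -/

theorem separableSpace_seq2 (k : ℕ) : TopologicalSpace.SeparableSpace (Seq2 k) := by
  classical
  have h : TopologicalSpace.IsSeparable (closure (Submodule.span ℂ (Set.range fun l : Fin k → ℤ =>
      (lp.single 2 l (1 : ℂ) : Seq2 k)) : Set (Seq2 k))) :=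
    ((Set.countable_range _).isSeparable.span (R := ℂ)).closure
  rw [← TopologicalSpace.isSeparable_univ_iff]
  refine h.mono fun ξ _ => ?_
  refine mem_closure_of_tendsto (lp.hasSum_single (by norm_num) ξ) (Eventually.of_forall fun s => ?_)
  refine Submodule.sum_mem _ fun l _ => ?_
  have : (lp.single 2 l (ξ l) : Seq2 k) = ξ l • lp.single 2 l (1 : ℂ) := by
    rw [← lp.single_smul, smul_eq_mul, mul_one]
  rw [this]
  exact Submodule.smul_mem _ _ (Submodule.subset_span ⟨l, rfl⟩)

/-- For fixed `ξ`, applying positivity of `B` to functions with fiber `1_E ξ` shows that `⟨ξ, s x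
ξ⟩` has real nonnegative integral over every measurable `E`. A countable dense set of `ξ` leaves a
single null set, and continuity covers the remaining vectors. -/
theorem IsFiberField.isPositive {B : L2 k →L[ℂ] L2 k} {s : RSpace k → (Seq2 k →L[ℂ] Seq2 k)}
    (h : IsFiberField B s) (hB : B.IsPositive) : ∀ᵐ x ∂(torusVol k), (s x).IsPositive := by
  have := separableSpace_seq2 k
  have key : ∀ ξ : Seq2 k, ∀ᵐ x ∂(torusVol k),
      0 ≤ (inner ℂ ξ (s x ξ)).re ∧ (inner ℂ ξ (s x ξ)).im = 0 := by
    intro ξ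
    have hint : Integrable (fun x => inner ℂ ξ (s x ξ)) (torusVol k) := by
      obtain ⟨M, hM⟩ := h.2.1
      refine Integrable.of_bound (h.1 ξ ξ).aestronglyMeasurable (‖ξ‖ * (M * ‖ξ‖)) ?_
      filter_upwards [hM] with x hx
      refine (norm_inner_le_norm _ _).trans ?_
      gcongr
      exact ((s x).le_opNorm ξ).trans (by gcongr)
    have hset : ∀ E : Set (RSpace k), MeasurableSet E →
        ∃ f : L2 k, ∫ x in E, inner ℂ ξ (s x ξ) ∂(torusVol k) = inner ℂ f (B f) := by
      intro E hE
      obtain ⟨f, hf⟩ := exists_gam_eq (k := k) ((memLp_const ξ).indicator hE)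
      refine ⟨f, ?_⟩
      rw [inner_eq_integral_gam, ← integral_indicator hE]
      refine integral_congr_ae ?_
      filter_upwards [hf, h.2.2 f] with x h1 h2
      rw [← h2, h1]
      by_cases hx : x ∈ E
      · simp [Set.indicator_of_mem hx]
      · simp [Set.indicator_of_notMem hx]
    have hre := ae_nonneg_of_forall_setIntegral_nonneg hint.re fun E hE _ => by
      obtain ⟨f, hf⟩ := hset E hE
      have : ∫ x in E, RCLike.re (inner ℂ ξ (s x ξ)) ∂(torusVol k) =
        RCLike.re (∫ x in E, inner ℂ ξ (s x ξ) ∂(torusVol k)) := integral_re hint.integrableOn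
      rw [this, hf]
      exact hB.re_inner_nonneg_right f
    have him := hint.im.ae_eq_zero_of_forall_setIntegral_eq_zero fun E hE _ => by
      obtain ⟨f, hf⟩ := hset E hE
      have : ∫ x in E, RCLike.im (inner ℂ ξ (s x ξ)) ∂(torusVol k) =
        RCLike.im (∫ x in E, inner ℂ ξ (s x ξ) ∂(torusVol k)) := integral_im hint.integrableOn
      rw [this, hf]
      exact hB.isSymmetric.im_inner_self_apply f
    filter_upwards [hre, him] with x h1 h2 using ⟨h1, h2⟩
  filter_upwards [ae_all_iff.2 fun j => key (TopologicalSpace.denseSeq (Seq2 k) j)] with x hx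
  have hall : ∀ ξ, 0 ≤ (inner ℂ ξ (s x ξ)).re ∧ (inner ℂ ξ (s x ξ)).im = 0 := by
    intro ξ
    have hc : Continuous fun ξ => inner ℂ ξ (s x ξ) := continuous_id.inner (s x).continuous
    refine (TopologicalSpace.denseRange_denseSeq (Seq2 k)).induction_on ξ ?_ hx
    exact (isClosed_le continuous_const (Complex.continuous_re.comp hc)).inter
      (isClosed_eq (Complex.continuous_im.comp hc) continuous_const)
  rw [ContinuousLinearMap.isPositive_def]
  refine ⟨?_, fun ξ => ?_⟩
  · rw [LinearMap.isSymmetric_iff_inner_map_self_real]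
    intro ξ
    rw [inner_conj_symm]
    change inner ℂ ξ (s x ξ) = inner ℂ (s x ξ) ξ
    rw [← inner_conj_symm (s x ξ) ξ]
    exact (Complex.conj_eq_iff_im.2 (hall ξ).2).symm
  · rw [ContinuousLinearMap.reApplyInnerSelf_apply, inner_re_symm]
    exact (hall ξ).1

end

section

/-! ### Spectral decompositions and Weyl's inequalities -/

section Spectral

variable {H : Type*} [NormedAddCommGroup H] [InnerProductSpace ℂ H]

/-- The first `d` vectors of `v` are orthonormal, the other ones vanish. -/
def IsTruncatedOrthonormal {n : ℕ} (d : ℕ) (v : Fin n → H) : Prop :=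
  ∀ i j, inner ℂ (v i) (v j) = if i = j ∧ (i : ℕ) < d then 1 else 0

/-- `T = ∑ i, lam i ⟨v i, ·⟩ v i` with non-increasing eigenvalues `lam i ≥ 0` and a family `v`
whose first `d` vectors are orthonormal, the other ones being zero. -/
structure IsSpectral {n : ℕ} (T : H →L[ℂ] H) (d : ℕ) (v : Fin n → H) (lam : ℕ → ℝ) : Prop where
  le : d ≤ n
  antitone : Antitone lam
  nonneg : ∀ i, 0 ≤ lam i
  eq_zero : ∀ i, d ≤ i → lam i = 0
  orthonormal : IsTruncatedOrthonormal d v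
  apply : ∀ w, T w = ∑ i : Fin n, ((lam i : ℂ) * inner ℂ (v i) w) • v i

variable {n d : ℕ} {T : H →L[ℂ] H} {v : Fin n → H} {lam : ℕ → ℝ}

theorem IsTruncatedOrthonormal.orthonormal_comp (h : IsTruncatedOrthonormal d v) {ι : Type*}
    {f : ι → Fin n} (hf : Function.Injective f) (hd : ∀ i, (f i : ℕ) < d) :
    Orthonormal ℂ (v ∘ f) := by
  classical
  rw [orthonormal_iff_ite]
  intro i j
  rw [Function.comp_apply, Function.comp_apply, h]
  simp [hd i, hf.eq_iff]

theorem IsTruncatedOrthonormal.sum_sq_le (h : IsTruncatedOrthonormal d v) (w : H) :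
    ∑ i, ‖inner ℂ (v i) w‖ ^ 2 ≤ ‖w‖ ^ 2 := by
  have ho := h.orthonormal_comp (f := fun i : {i : Fin n // (i : ℕ) < d} => i.1)
    Subtype.val_injective fun i => i.2
  refine le_trans ?_ (ho.sum_inner_products_le (s := Finset.univ) w)
  have h0 : ∀ i ∈ Finset.univ, ‖inner ℂ (v i) w‖ ^ 2 ≠ 0 → (i : ℕ) < d := by
    intro i _ hi
    by_contra hid
    have : v i = 0 := by rw [← inner_self_eq_zero (𝕜 := ℂ), h]; simp [hid]
    simp [this] at hi
  rw [← Finset.sum_filter_of_ne h0]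
  exact (Finset.sum_subtype _ (by simp) _).le

theorem IsSpectral.apply_vec (h : IsSpectral T d v lam) (i : Fin n) :
    T (v i) = (lam i : ℂ) • v i := by
  rw [h.apply, Finset.sum_eq_single i]
  · rw [h.orthonormal]
    by_cases hi : (i : ℕ) < d
    · simp [hi]
    · simp [h.eq_zero i (not_lt.1 hi)]
  · intro j _ hj
    rw [h.orthonormal]
    simp [hj]
  · simp

theorem IsSpectral.inner_apply (h : IsSpectral T d v lam) (w : H) :
    (inner ℂ w (T w)).re = ∑ i : Fin n, lam i * ‖inner ℂ (v i) w‖ ^ 2 := by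
  rw [h.apply, inner_sum, Complex.re_sum]
  refine Finset.sum_congr rfl fun i _ => ?_
  rw [inner_smul_right, mul_assoc, ← inner_conj_symm w, Complex.mul_conj', Complex.re_ofReal_mul]
  norm_cast

/-- Vectors orthogonal to the first `j` eigenvectors. -/
theorem IsSpectral.le_of_forall_mem (h : IsSpectral T d v lam) {W : Submodule ℂ H}
    [FiniteDimensional ℂ W] {j : ℕ} (hj : j < Module.finrank ℂ W) {t : ℝ}
    (ht : ∀ w ∈ W, t * ‖w‖ ^ 2 ≤ (inner ℂ w (T w)).re) : t ≤ lam j := by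
  -- Indices `i ≥ n` carry no eigenvector, and the zero functional imposes no condition.
  set L : W →ₗ[ℂ] (Fin j → ℂ) := LinearMap.pi fun i =>
    (if hi : (i : ℕ) < n then (innerSL ℂ (v ⟨i, hi⟩) : H →ₗ[ℂ] ℂ) else 0).comp W.subtype with hL
  have hker : L.ker ≠ ⊥ := LinearMap.ker_ne_bot_of_finrank_lt (by simpa using hj)
  obtain ⟨w, hw, hw0⟩ := Submodule.exists_mem_ne_zero_of_ne_bot hker
  have hw1 : ∀ i : Fin n, (i : ℕ) < j → inner ℂ (v i) (w : H) = 0 := by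
    intro i hi
    have := congrFun (LinearMap.mem_ker.1 hw) ⟨i, hi⟩
    simpa [hL] using this
  have hw2 : t * ‖(w : H)‖ ^ 2 ≤ lam j * ‖(w : H)‖ ^ 2 := by
    refine (ht w w.2).trans ?_
    rw [h.inner_apply]
    calc ∑ i : Fin n, lam i * ‖inner ℂ (v i) (w : H)‖ ^ 2
        ≤ ∑ i : Fin n, lam j * ‖inner ℂ (v i) (w : H)‖ ^ 2 := by
          refine Finset.sum_le_sum fun i _ => ?_
          by_cases hi : (i : ℕ) < j
          · simp [hw1 i hi]
          · have := h.antitone (not_lt.1 hi)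
            gcongr
      _ ≤ lam j * ‖(w : H)‖ ^ 2 := by
          rw [← Finset.mul_sum]
          exact mul_le_mul_of_nonneg_left (h.orthonormal.sum_sq_le _) (h.nonneg j)
  have hpos : 0 < ‖(w : H)‖ ^ 2 := by
    have : (w : H) ≠ 0 := by simpa using hw0
    positivity
  exact le_of_mul_le_mul_right hw2 hpos

/-- The span of the first `j + 1` eigenvectors. -/
theorem IsSpectral.exists_submodule (h : IsSpectral T d v lam) {j : ℕ} (hj : 0 < lam j) :
    ∃ W : Submodule ℂ H, FiniteDimensional ℂ W ∧ Module.finrank ℂ W = j + 1 ∧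
      ∀ w ∈ W, lam j * ‖w‖ ^ 2 ≤ (inner ℂ w (T w)).re := by
  have hjd : j < d := by
    by_contra hlt
    exact hj.ne' (h.eq_zero j (not_lt.1 hlt))
  set f : Fin (j + 1) → Fin n := Fin.castLE (by have := h.le; omega) with hf
  have ho := h.orthonormal.orthonormal_comp (f := f) (Fin.castLE_injective _)
    fun i => by simp only [hf, Fin.val_castLE]; omega
  refine ⟨Submodule.span ℂ (Set.range (v ∘ f)),
    FiniteDimensional.span_of_finite ℂ (Set.finite_range _), ?_, fun w hw => ?_⟩
  · rw [finrank_span_eq_card ho.linearIndependent, Fintype.card_fin]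
  · obtain ⟨c, rfl⟩ := (Submodule.mem_span_range_iff_exists_fun ℂ).1 hw
    have e1 : ‖∑ i, c i • (v ∘ f) i‖ ^ 2 = ∑ i, ‖c i‖ ^ 2 := by
      have := ho.inner_sum c c Finset.univ
      rw [inner_self_eq_norm_sq_to_K] at this
      simp only [Complex.conj_mul'] at this
      have h' : ((‖∑ i, c i • (v ∘ f) i‖ ^ 2 : ℝ) : ℂ) = ((∑ i, ‖c i‖ ^ 2 : ℝ) : ℂ) := by
        push_cast; exact this
      exact_mod_cast h'
    have e2 : (inner ℂ (∑ i, c i • (v ∘ f) i) (T (∑ i, c i • (v ∘ f) i))).re =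
        ∑ i, lam (f i) * ‖c i‖ ^ 2 := by
      have : T (∑ i, c i • (v ∘ f) i) = ∑ i, (lam (f i) * c i : ℂ) • (v ∘ f) i := by
        rw [map_sum]
        refine Finset.sum_congr rfl fun i _ => ?_
        rw [map_smul, Function.comp_apply, h.apply_vec, smul_smul, mul_comm]
      rw [this, ho.inner_sum, Complex.re_sum]
      refine Finset.sum_congr rfl fun i _ => ?_
      rw [mul_left_comm, Complex.conj_mul', Complex.re_ofReal_mul]
      norm_cast
    rw [e1, e2, Finset.mul_sum]
    refine Finset.sum_le_sum fun i _ => ?_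
    have : lam j ≤ lam (f i) := h.antitone (by simp only [hf, Fin.val_castLE]; omega)
    gcongr

/-- Weyl's inequality: the eigenvalues are monotone. -/
theorem IsSpectral.mono {n' d' : ℕ} {T' : H →L[ℂ] H} {v' : Fin n' → H} {lam' : ℕ → ℝ}
    (h : IsSpectral T d v lam) (h' : IsSpectral T' d' v' lam')
    (hle : ∀ w, (inner ℂ w (T w)).re ≤ (inner ℂ w (T' w)).re) (j : ℕ) : lam j ≤ lam' j := by
  rcases (h.nonneg j).eq_or_lt with h0 | h0
  · rw [← h0]; exact h'.nonneg j
  · obtain ⟨W, _, hW, hT⟩ := h.exists_submodule h0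
    exact h'.le_of_forall_mem (W := W) (by omega) fun w hw => (hT w hw).trans (hle w)

/-- Weyl's inequality for perturbations of rank at most `r`. -/
theorem IsSpectral.le_of_finrank_range_le {n' d' : ℕ} {T' B : H →L[ℂ] H} {v' : Fin n' → H}
    {lam' : ℕ → ℝ} (h : IsSpectral T d v lam) (h' : IsSpectral T' d' v' lam')
    (hB : ∀ w, T' w = T w + B w) {r : ℕ} (hr : LinearMap.rank (B : H →ₗ[ℂ] H) ≤ r) (j : ℕ) :
    lam' (r + j) ≤ lam j := by
  rcases (h'.nonneg (r + j)).eq_or_lt with h0 | h0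
  · rw [← h0]; exact h.nonneg j
  · obtain ⟨W, _, hW, hT⟩ := h'.exists_submodule h0
    -- Passing from `W`, of dimension `r + j + 1`, to the kernel of `B` on it loses at most `r`
    -- dimensions, and `T'` and `T` agree there.
    set L : W →ₗ[ℂ] H := (B : H →ₗ[ℂ] H).comp W.subtype
    have h1 := L.finrank_range_add_finrank_ker
    have h2 : Module.finrank ℂ L.range ≤ r := by
      have : Module.rank ℂ L.range ≤ r :=
        (Submodule.rank_mono (LinearMap.range_comp_le_range _ _)).trans hr
      exact Module.finrank_le_of_rank_le this
    have h3 : Module.finrank ℂ (L.ker.map W.subtype) = Module.finrank ℂ L.ker :=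
      Submodule.finrank_map_subtype_eq W L.ker
    refine h.le_of_forall_mem (W := L.ker.map W.subtype) (j := j) (by omega) ?_
    rintro _ ⟨w, hw, rfl⟩
    have hw0 : B (w : H) = 0 := LinearMap.mem_ker.1 hw
    have := hT w w.2
    rw [hB, hw0, add_zero] at this
    exact this

/-- The spectral theorem for positive operators with range in a finite dimensional subspace. -/
theorem exists_isSpectral {J : Submodule ℂ H} [FiniteDimensional ℂ J] (hT : T.IsPositive)
    (hTJ : ∀ w, T w ∈ J) : ∃ (v : Fin (Module.finrank ℂ J) → H) (lam : ℕ → ℝ),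
      IsSpectral T (Module.finrank ℂ J) v lam ∧ ∀ i, v i ∈ J := by
  set R : J →ₗ[ℂ] J := (T : H →ₗ[ℂ] H).restrict fun w _ => hTJ w with hR
  have hRs : R.IsSymmetric := hT.isSymmetric.restrict_invariant fun w _ => hTJ w
  set b := hRs.eigenvectorBasis rfl with hb
  set a := hRs.eigenvalues rfl with ha
  have hTb : ∀ i, T (b i : H) = (a i : ℂ) • (b i : H) := fun i =>
    congrArg Subtype.val (hRs.apply_eigenvectorBasis rfl i)
  have hbn : ∀ i j, inner ℂ (b i : H) (b j : H) = if i = j then (1 : ℂ) else 0 := fun i j =>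
    orthonormal_iff_ite.1 b.orthonormal i j
  have ha0 : ∀ i, 0 ≤ a i := fun i => by
    have := hT.re_inner_nonneg_right (b i : H)
    rw [hTb, inner_smul_right, hbn] at this
    simpa using this
  set lam : ℕ → ℝ := fun i => if h : i < Module.finrank ℂ J then a ⟨i, h⟩ else 0 with hlam
  have hla : ∀ i : Fin (Module.finrank ℂ J), lam i = a i := fun i => by simp [hlam]
  refine ⟨fun i => b i, lam, ⟨le_rfl, ?_, ?_, ?_, ?_, ?_⟩, fun i => (b i).2⟩
  · intro i j hij
    simp only [hlam]
    by_cases hj : j < Module.finrank ℂ J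
    · rw [dif_pos hj, dif_pos (hij.trans_lt hj)]
      exact hRs.eigenvalues_antitone rfl hij
    · rw [dif_neg hj]
      split_ifs
      exacts [ha0 _, le_rfl]
  · intro i
    simp only [hlam]
    split_ifs
    exacts [ha0 _, le_rfl]
  · intro i hi
    simp [hlam, not_lt.2 hi]
  · intro i j
    rw [hbn]
    simp
  · intro w
    have h1 := congrArg Subtype.val (b.sum_repr ⟨T w, hTJ w⟩)
    refine h1.symm.trans ?_
    simp only [Submodule.coe_sum, Submodule.coe_smul]
    refine Finset.sum_congr rfl fun i _ => ?_
    congr 1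
    rw [b.repr_apply_apply, Submodule.coe_inner, hla]
    change inner ℂ (b i : H) (T w) = _
    rw [← hT.inner_left_eq_inner_right, hTb, inner_smul_left, Complex.conj_ofReal]

end Spectral

/-- For `t > 0` the eigenspaces with eigenvalue at least `t` span the `v i` with `lam i ≥ t`, and as
`lam` decreases there are more than `j` of these exactly when `t ≤ lam j`. The value `t = 0`, where
the kernel enters, does not affect the supremum. -/
theorem eigSeq_eq {k n d : ℕ} {T : Seq2 k →L[ℂ] Seq2 k} {v : Fin n → Seq2 k} {lam : ℕ → ℝ}
    (h : IsSpectral T d v lam) (j : ℕ) : eigSeq T j = lam j := by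
  classical
  have key : ∀ t : ℝ, 0 < t → (j < Module.finrank ℂ
      (⨆ (s : ℝ) (_ : t ≤ s), Module.End.eigenspace (T : Seq2 k →ₗ[ℂ] Seq2 k) (s : ℂ) :
        Submodule ℂ (Seq2 k)) ↔ t ≤ lam j) := by
    intro t ht
    have hlt : ∀ i : ℕ, t ≤ lam i → i < d := fun i hi => by
      by_contra hd
      rw [h.eq_zero i (not_lt.1 hd)] at hi
      exact absurd hi (not_le.2 ht)
    have e : (⨆ (s : ℝ) (_ : t ≤ s), Module.End.eigenspace (T : Seq2 k →ₗ[ℂ] Seq2 k) (s : ℂ) :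
        Submodule ℂ (Seq2 k)) =
        Submodule.span ℂ (Set.range fun i : {i : Fin n // t ≤ lam i} => v i.1) := by
      refine le_antisymm ?_ ?_
      · refine iSup₂_le fun s hs w hw => ?_
        rw [Module.End.mem_eigenspace_iff] at hw
        have hw' : T w = (s : ℂ) • w := hw
        have hs0 : (s : ℂ) ≠ 0 := by exact_mod_cast (ht.trans_le hs).ne'
        have hws : w = ∑ i : Fin n, ((s : ℂ)⁻¹ * ((lam i : ℂ) * inner ℂ (v i) w)) • v i := by
          have := congrArg (fun z => (s : ℂ)⁻¹ • z) hw'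
          simp only [smul_smul, inv_mul_cancel₀ hs0, one_smul] at this
          refine this.symm.trans ?_
          rw [h.apply, Finset.smul_sum]
          simp only [smul_smul]
        rw [hws]
        refine Submodule.sum_mem _ fun i _ => ?_
        by_cases hi : t ≤ lam i
        · exact Submodule.smul_mem _ _ (Submodule.subset_span ⟨⟨i, hi⟩, rfl⟩)
        -- Pairing `T w = s w` with `v i` gives `(s - lam i) ⟨v i, w⟩ = 0`, and `s ≥ t > lam i`.
        · have h0 : inner ℂ (v i) w = 0 := by
            by_cases hid : (i : ℕ) < d
            · have h1 : inner ℂ (v i) (T w) = (lam i : ℂ) * inner ℂ (v i) w := by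
                rw [h.apply, inner_sum, Finset.sum_eq_single i]
                · rw [inner_smul_right, h.orthonormal]; simp [hid]
                · intro m _ hm
                  rw [inner_smul_right, h.orthonormal]; simp [Ne.symm hm]
                · simp
              rw [hw', inner_smul_right] at h1
              have h2 : ((s : ℂ) - lam i) * inner ℂ (v i) w = 0 := by rw [sub_mul, h1, sub_self]
              refine (mul_eq_zero.1 h2).resolve_left fun h3 => hi ?_
              have : s = lam i := by exact_mod_cast sub_eq_zero.1 h3
              rw [← this]; exact hs
            · have : v i = 0 := by
                rw [← inner_self_eq_zero (𝕜 := ℂ), h.orthonormal]; simp [hid]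
              rw [this, inner_zero_left]
          rw [h0, mul_zero, mul_zero, zero_smul]
          exact Submodule.zero_mem _
      · rw [Submodule.span_le]
        rintro _ ⟨⟨i, hi⟩, rfl⟩
        refine Submodule.mem_iSup_of_mem (lam i) (Submodule.mem_iSup_of_mem hi ?_)
        rw [Module.End.mem_eigenspace_iff]
        exact h.apply_vec i
    have ho := h.orthonormal.orthonormal_comp (f := fun i : {i : Fin n // t ≤ lam i} => i.1)
      Subtype.val_injective fun i => hlt _ i.2
    rw [e]
    have hcard : Module.finrank ℂ
        (Submodule.span ℂ (Set.range fun i : {i : Fin n // t ≤ lam i} => v i.1)) =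
        (Finset.univ.filter fun i : Fin n => t ≤ lam i).card := by
      have := finrank_span_eq_card ho.linearIndependent
      rw [Fintype.card_subtype] at this
      exact this
    rw [hcard]
    constructor
    · intro hj
      by_contra hlam
      have hsub : (Finset.univ.filter fun i : Fin n => t ≤ lam i).image (fun i : Fin n => (i : ℕ)) ⊆
          Finset.range j := by
        intro m hm
        simp only [Finset.mem_image, Finset.mem_filter, Finset.mem_univ, true_and] at hm
        obtain ⟨i, hi, rfl⟩ := hm
        rw [Finset.mem_range]
        by_contra hij
        exact hlam (hi.trans (h.antitone (not_lt.1 hij)))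
      have := Finset.card_le_card hsub
      rw [Finset.card_image_of_injective _ Fin.val_injective, Finset.card_range] at this
      omega
    · intro hj
      have hjn : j < n := (hlt j hj).trans_le h.le
      have hsub : Finset.range (j + 1) ⊆
          (Finset.univ.filter fun i : Fin n => t ≤ lam i).image (fun i : Fin n => (i : ℕ)) := by
        intro m hm
        rw [Finset.mem_range] at hm
        simp only [Finset.mem_image, Finset.mem_filter, Finset.mem_univ, true_and]
        exact ⟨⟨m, by omega⟩, hj.trans (h.antitone (show m ≤ j by omega)), rfl⟩
      have := Finset.card_le_card hsub
      rw [Finset.card_image_of_injective _ Fin.val_injective, Finset.card_range] at this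
      omega
  rw [eigSeq]
  rcases (h.nonneg j).eq_or_lt with h0 | h0
  · rw [← h0]
    refine le_antisymm (Real.sSup_nonpos fun t ht => ?_) (Real.sSup_nonneg fun t ht => ht.1)
    by_contra hpos
    exact hpos (h0 ▸ (key t (not_le.1 hpos)).1 ht.2)
  · refine IsGreatest.csSup_eq ⟨⟨h0.le, (key _ h0).2 le_rfl⟩, fun t ht => ?_⟩
    rcases ht.1.eq_or_lt with ht0 | ht0
    · rw [← ht0]; exact h.nonneg j
    · exact (key t ht0).1 ht.2

end

section

/-! ### The inverse eigenvalue problem for rank one and finite rank perturbations -/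

section RankOne

variable {d : ℕ}

open Polynomial in
/-- The weights of the secular equation. -/
theorem exists_weights_secular {a b : Fin d → ℝ} (h1 : ∀ i, a i < b i)
    (h2 : ∀ i j, i < j → b j < a i) :
    ∃ c : Fin d → ℝ, (∀ i, 0 < c i) ∧ ∀ m, ∑ i, c i / (b m - a i) = 1 := by
  have hinj : Set.InjOn a (Finset.univ : Finset (Fin d)) := by
    intro i _ j _ hij
    rcases lt_trichotomy i j with h | h | h
    · exact absurd hij ((h1 j).trans (h2 i j h)).ne'
    · exact h
    · exact absurd hij ((h1 i).trans (h2 j i h)).ne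
  have hne : ∀ m i, b m - a i ≠ 0 := by
    intro m i
    rcases lt_trichotomy i m with h | h | h
    · exact (sub_neg.2 (h2 i m h)).ne
    · rw [h]; exact (sub_pos.2 (h1 m)).ne'
    · exact (sub_pos.2 ((h1 i).trans ((h2 m i h).trans (h1 m)))).ne'
  set q : ℝ[X] := Lagrange.nodal Finset.univ b
  set p : ℝ[X] := Lagrange.nodal Finset.univ a
  have hdeg : (q - p).degree < (Finset.univ : Finset (Fin d)).card := by
    have := degree_sub_lt_left (p := q) (q := p)
      (by rw [Lagrange.degree_nodal, Lagrange.degree_nodal])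
      Lagrange.nodal_ne_zero
      (by rw [Lagrange.nodal_monic.leadingCoeff, Lagrange.nodal_monic.leadingCoeff])
    rwa [Lagrange.degree_nodal] at this
  have hint := Lagrange.eq_interpolate hinj hdeg
  -- The weights are minus the residues of `q / p`: the expansion `q / p = 1 - ∑ c i / (X - a i)` is
  -- evaluated at the zeros `b m` of `q`.
  refine ⟨fun i => -(q.eval (a i) * Lagrange.nodalWeight Finset.univ a i), fun i => ?_,
    fun m => ?_⟩
  · have : -(q.eval (a i) * Lagrange.nodalWeight Finset.univ a i) =
        (b i - a i) * ∏ j ∈ Finset.univ.erase i, ((a i - b j) * (a i - a j)⁻¹) := by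
      rw [Lagrange.eval_nodal, Lagrange.nodalWeight, Finset.prod_mul_distrib,
        ← Finset.mul_prod_erase Finset.univ (fun j => a i - b j) (Finset.mem_univ i)]
      ring
    refine lt_of_lt_of_eq ?_ this.symm
    refine mul_pos (sub_pos.2 (h1 i)) (Finset.prod_pos fun j hj => ?_)
    -- By interlacing, `a i - b j` and `a i - a j` are both negative for `j < i` and both positive
    -- for `j > i`.
    rcases lt_or_gt_of_ne (Finset.ne_of_mem_erase hj) with h | h
    · exact mul_pos_of_neg_of_neg (sub_neg.2 ((h1 i).trans ((h2 j i h).trans (h1 j))))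
        (inv_lt_zero.2 (sub_neg.2 ((h1 i).trans (h2 j i h))))
    · exact mul_pos (sub_pos.2 (h2 i j h)) (inv_pos.2 (sub_pos.2 ((h1 j).trans (h2 i j h))))
  · have hm := congrArg (fun f : ℝ[X] => f.eval (b m)) hint
    have hp0 : p.eval (b m) ≠ 0 := by
      rw [Lagrange.eval_nodal]
      exact Finset.prod_ne_zero_iff.2 fun i _ => hne m i
    have hq0 : ∀ i, (q - p).eval (a i) = q.eval (a i) := fun i => by
      rw [eval_sub, Lagrange.eval_nodal_at_node (Finset.mem_univ i), sub_zero]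
    simp only [hq0] at hm
    rw [Lagrange.eval_interpolate_not_at_node _ fun i _ => sub_ne_zero.1 (hne m i), eval_sub,
      Lagrange.eval_nodal_at_node (Finset.mem_univ m), zero_sub, ← mul_neg_one] at hm
    have := mul_left_cancel₀ hp0 hm
    rw [← neg_inj]
    refine Eq.trans ?_ this.symm
    rw [← Finset.sum_neg_distrib]
    refine Finset.sum_congr rfl fun i _ => ?_
    rw [div_eq_mul_inv]
    ring

/-- `diag a + y yᵀ = Q (diag b) Qᵀ` with `Q` orthogonal. -/
def IsRankOneUpdate (a b y : Fin d → ℝ) (Q : Fin d → Fin d → ℝ) : Prop :=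
  (∀ i j, ∑ l, Q l i * Q l j = if i = j then 1 else 0) ∧
    ∀ i j, (if i = j then a i else 0) + y i * y j = ∑ l, Q i l * b l * Q j l

/-- Put `y i = √(c i)`. The secular equation at `b m` says precisely that the vector with entries `y
i / (b m - a i)` is an eigenvector of `diag a + y yᵀ` for `b m`. The `b m` are distinct, so these
vectors are orthogonal; normalized, they are the columns of `Q`. -/
theorem exists_isRankOneUpdate_of_lt {a b : Fin d → ℝ} (h1 : ∀ i, a i < b i)
    (h2 : ∀ i j, i < j → b j < a i) : ∃ y Q, IsRankOneUpdate a b y Q := by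
  obtain ⟨c, hc, hsec⟩ := exists_weights_secular h1 h2
  have hne : ∀ m i, b m - a i ≠ 0 := by
    intro m i
    rcases lt_trichotomy i m with h | h | h
    · exact (sub_neg.2 (h2 i m h)).ne
    · rw [h]; exact (sub_pos.2 (h1 m)).ne'
    · exact (sub_pos.2 ((h1 i).trans ((h2 m i h).trans (h1 m)))).ne'
  have hbne : ∀ l m, l ≠ m → b l ≠ b m := by
    intro l m hlm
    rcases lt_or_gt_of_ne hlm with h | h
    · exact ((h2 l m h).trans (h1 l)).ne'
    · exact ((h2 m l h).trans (h1 m)).ne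
  set y : Fin d → ℝ := fun i => Real.sqrt (c i) with hy
  have hyy : ∀ i, y i * y i = c i := fun i => Real.mul_self_sqrt (hc i).le
  set x : Fin d → Fin d → ℝ := fun i m => y i / (b m - a i) with hx
  have hyx : ∀ m, ∑ i, y i * x i m = 1 := fun m => by
    rw [← hsec m]
    refine Finset.sum_congr rfl fun i _ => ?_
    rw [hx, ← hyy i, mul_div_assoc]
  have hMx : ∀ i m, a i * x i m + y i = b m * x i m := fun i m => by
    simp only [hx]
    field_simp [hne m i]
    ring
  have horth : ∀ l m, l ≠ m → ∑ i, x i l * x i m = 0 := by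
    intro l m hlm
    have e1 : b l * ∑ i, x i l * x i m = ∑ i, a i * x i l * x i m + 1 := by
      rw [← hyx m, Finset.mul_sum, ← Finset.sum_add_distrib]
      refine Finset.sum_congr rfl fun i _ => ?_
      linear_combination -(x i m) * hMx i l
    have e2 : b m * ∑ i, x i l * x i m = ∑ i, a i * x i l * x i m + 1 := by
      rw [← hyx l, Finset.mul_sum, ← Finset.sum_add_distrib]
      refine Finset.sum_congr rfl fun i _ => ?_
      linear_combination -(x i l) * hMx i m
    have : (b l - b m) * ∑ i, x i l * x i m = 0 := by rw [sub_mul, e1, e2, sub_self]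
    exact (mul_eq_zero.1 this).resolve_left (sub_ne_zero.2 (hbne l m hlm))
  set s : Fin d → ℝ := fun m => ∑ i, x i m * x i m with hs
  have hspos : ∀ m, 0 < s m := by
    intro m
    refine lt_of_le_of_ne (Finset.sum_nonneg fun i _ => mul_self_nonneg _) fun h0 => ?_
    have hz := (Finset.sum_eq_zero_iff_of_nonneg fun i _ => mul_self_nonneg (x i m)).1 h0.symm
    have := hyx m
    rw [Finset.sum_eq_zero fun i hi => by rw [mul_self_eq_zero.1 (hz i hi), mul_zero]] at this
    exact zero_ne_one this
  set Q : Fin d → Fin d → ℝ := fun i m => x i m / Real.sqrt (s m) with hQ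
  have hQQ : ∀ i j, ∑ l, Q l i * Q l j = if i = j then 1 else 0 := by
    intro i j
    have : ∑ l, Q l i * Q l j = (∑ l, x l i * x l j) / (Real.sqrt (s i) * Real.sqrt (s j)) := by
      rw [Finset.sum_div]
      exact Finset.sum_congr rfl fun l _ => by simp only [hQ]; rw [div_mul_div_comm]
    rw [this]
    split_ifs with hij
    · subst hij
      rw [Real.mul_self_sqrt (hspos i).le]
      exact div_self (hspos i).ne'
    · rw [horth i j hij, zero_div]
  have hQM : (Matrix.of Q).transpose * Matrix.of Q = 1 := by
    ext i j
    simp only [Matrix.mul_apply, Matrix.transpose_apply, Matrix.of_apply, hQQ, Matrix.one_apply]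
  have hQM' := mul_eq_one_comm.1 hQM
  have hMQ : (Matrix.of fun i j => (if i = j then a i else 0) + y i * y j) * Matrix.of Q =
      Matrix.of Q * Matrix.diagonal b := by
    ext i m
    rw [Matrix.mul_diagonal, Matrix.mul_apply]
    simp only [Matrix.of_apply, add_mul, ite_mul, zero_mul,
      Finset.sum_add_distrib, Finset.sum_ite_eq, Finset.mem_univ, if_true]
    have e : ∑ j, y i * y j * Q j m = y i / Real.sqrt (s m) := by
      have : ∑ j, y i * y j * Q j m = y i / Real.sqrt (s m) * ∑ j, y j * x j m := by
        rw [Finset.mul_sum]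
        exact Finset.sum_congr rfl fun j _ => by simp only [hQ]; ring
      rw [this, hyx, mul_one]
    rw [e]
    simp only [hQ]
    rw [← mul_div_assoc, ← add_div, hMx, div_mul_eq_mul_div, mul_comm]
  refine ⟨y, Q, hQQ, fun i j => ?_⟩
  have hfin : (Matrix.of fun i j => (if i = j then a i else 0) + y i * y j) =
      Matrix.of Q * Matrix.diagonal b * (Matrix.of Q).transpose := by
    rw [← hMQ, mul_assoc, hQM', mul_one]
  have := congrFun (congrFun hfin i) j
  rw [Matrix.mul_apply] at this
  simp only [Matrix.mul_diagonal, Matrix.of_apply, Matrix.transpose_apply] at this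
  exact this

theorem isClosed_isRankOneUpdate : IsClosed {p : ((Fin d → ℝ) × (Fin d → ℝ)) ×
    ((Fin d → ℝ) × (Fin d → Fin d → ℝ)) | IsRankOneUpdate p.1.1 p.1.2 p.2.1 p.2.2} := by
  simp only [IsRankOneUpdate, Set.ofPred_and, Set.ofPred_forall]
  refine (isClosed_iInter fun i => isClosed_iInter fun j => isClosed_eq ?_ ?_).inter
    (isClosed_iInter fun i => isClosed_iInter fun j => isClosed_eq ?_ ?_)
  · fun_prop
  · fun_prop
  · split_ifs <;> fun_prop
  · fun_prop

/-- Entries of an orthogonal matrix are at most `1` in modulus, and the diagonal of the identity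
then bounds `y i ^ 2`. This gives the compactness used to pass to the limit. -/
theorem IsRankOneUpdate.norm_le {a b y : Fin d → ℝ} {Q : Fin d → Fin d → ℝ}
    (h : IsRankOneUpdate a b y Q) {R : ℝ} (hR : 0 ≤ R) (ha : ∀ i, |a i| ≤ R)
    (hb : ∀ i, |b i| ≤ R) :
    ‖(y, Q)‖ ≤ max (Real.sqrt (d * R + R)) 1 := by
  have hQ : ∀ i j, Q i j * Q i j ≤ 1 := by
    intro i j
    have := h.1 j j
    rw [if_pos rfl] at this
    rw [← this]
    exact Finset.single_le_sum (f := fun l => Q l j * Q l j) (fun l _ => mul_self_nonneg _)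
      (Finset.mem_univ i)
  rw [Prod.norm_def]
  refine max_le_max ?_ ?_
  · refine (pi_norm_le_iff_of_nonneg (Real.sqrt_nonneg _)).2 fun i => ?_
    rw [Real.norm_eq_abs]
    refine Real.abs_le_sqrt ?_
    have := h.2 i i
    rw [if_pos rfl] at this
    have h3 : ∑ l, Q i l * b l * Q i l ≤ d * R := by
      calc ∑ l, Q i l * b l * Q i l ≤ ∑ _l : Fin d, R := by
            refine Finset.sum_le_sum fun l _ => ?_
            have h4 : Q i l * b l * Q i l = (Q i l * Q i l) * b l := by ring
            rw [h4]
            calc Q i l * Q i l * b l ≤ Q i l * Q i l * R := by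
                  exact mul_le_mul_of_nonneg_left ((le_abs_self _).trans (hb l)) (mul_self_nonneg _)
              _ ≤ 1 * R := mul_le_mul_of_nonneg_right (hQ i l) hR
              _ = R := one_mul R
        _ = d * R := by simp
    have h5 := (abs_le.1 (ha i)).1
    rw [sq]
    linarith
  · refine (pi_norm_le_iff_of_nonneg zero_le_one).2 fun i =>
      (pi_norm_le_iff_of_nonneg zero_le_one).2 fun j => ?_
    rw [Real.norm_eq_abs]
    exact abs_le_one_iff_mul_self_le_one.2 (hQ i j)

/-- Weakly interlacing data are limits of strictly interlacing ones; the solutions stay bounded, and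
the relation is closed. -/
theorem exists_isRankOneUpdate {a b : Fin d → ℝ} (h1 : ∀ i, a i ≤ b i)
    (h2 : ∀ i j, i < j → b j ≤ a i) : ∃ y Q, IsRankOneUpdate a b y Q := by
  set ε : ℕ → ℝ := fun m => 1 / ((m : ℝ) + 1) with hε
  have hε0 : ∀ m, 0 < ε m := fun m => by positivity
  have hε1 : ∀ m, ε m ≤ 1 := fun m => by
    simp only [hε]
    rw [div_le_one (by positivity)]
    linarith [(Nat.cast_nonneg m : (0 : ℝ) ≤ m)]
  have hlim : Tendsto ε atTop (nhds 0) := tendsto_one_div_add_atTop_nhds_zero_nat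
  -- Along the chain `b 0 ≥ a 0 ≥ b 1 ≥ a 1 ≥ …` the terms are lowered by `0, ε, 2ε, 3ε, …`, making
  -- every inequality strict.
  set A : ℕ → Fin d → ℝ := fun m i => a i - (2 * i + 1) * ε m with hA
  set B : ℕ → Fin d → ℝ := fun m i => b i - 2 * i * ε m with hB
  have hex : ∀ m, ∃ p : (Fin d → ℝ) × (Fin d → Fin d → ℝ),
      IsRankOneUpdate (A m) (B m) p.1 p.2 := by
    intro m
    obtain ⟨y, Q, h⟩ := exists_isRankOneUpdate_of_lt (a := A m) (b := B m)
      (fun i => by simp only [hA, hB]; nlinarith [h1 i, hε0 m])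
      (fun i j hij => by
        simp only [hA, hB]
        have : (i : ℝ) + 1 ≤ j := by exact_mod_cast hij
        nlinarith [h2 i j hij, hε0 m])
    exact ⟨(y, Q), h⟩
  choose p hp using hex
  set R : ℝ := ∑ i, |a i| + ∑ i, |b i| + (2 * d + 1) with hR
  have hbd : ∀ m, p m ∈ Metric.closedBall (0 : (Fin d → ℝ) × (Fin d → Fin d → ℝ))
      (max (Real.sqrt (d * R + R)) 1) := by
    intro m
    rw [mem_closedBall_zero_iff]
    have ha : ∀ i, |a i| ≤ ∑ i, |a i| := fun i =>
      Finset.single_le_sum (f := fun i => |a i|) (fun _ _ => abs_nonneg _) (Finset.mem_univ i)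
    have hb : ∀ i, |b i| ≤ ∑ i, |b i| := fun i =>
      Finset.single_le_sum (f := fun i => |b i|) (fun _ _ => abs_nonneg _) (Finset.mem_univ i)
    have hsa : 0 ≤ ∑ i, |a i| := Finset.sum_nonneg fun _ _ => abs_nonneg _
    have hsb : 0 ≤ ∑ i, |b i| := Finset.sum_nonneg fun _ _ => abs_nonneg _
    refine (hp m).norm_le (R := R) (by positivity) (fun i => ?_) (fun i => ?_)
    · have hi : (i : ℝ) ≤ d := by exact_mod_cast i.2.le
      refine (abs_sub _ _).trans ?_
      rw [abs_of_nonneg (by have := hε0 m; positivity : 0 ≤ (2 * (i : ℝ) + 1) * ε m)]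
      have : (2 * (i : ℝ) + 1) * ε m ≤ (2 * (i : ℝ) + 1) * 1 :=
        mul_le_mul_of_nonneg_left (hε1 m) (by positivity)
      linarith [ha i]
    · have hi : (i : ℝ) ≤ d := by exact_mod_cast i.2.le
      refine (abs_sub _ _).trans ?_
      rw [abs_of_nonneg (by have := hε0 m; positivity : 0 ≤ 2 * (i : ℝ) * ε m)]
      have : 2 * (i : ℝ) * ε m ≤ 2 * (i : ℝ) * 1 :=
        mul_le_mul_of_nonneg_left (hε1 m) (by positivity)
      linarith [hb i]
  obtain ⟨q, -, φ, hφ, hq⟩ := (isCompact_closedBall _ _).tendsto_subseq hbd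
  have hA' : Tendsto A atTop (nhds a) := by
    refine tendsto_pi_nhds.2 fun i => ?_
    have := (hlim.const_mul (2 * (i : ℝ) + 1)).const_sub (a i)
    simpa using this
  have hB' : Tendsto B atTop (nhds b) := by
    refine tendsto_pi_nhds.2 fun i => ?_
    have := (hlim.const_mul (2 * (i : ℝ))).const_sub (b i)
    simpa using this
  refine ⟨q.1, q.2, ?_⟩
  exact isClosed_isRankOneUpdate.mem_of_tendsto (x := ((a, b), q))
    (((hA'.comp hφ.tendsto_atTop).prodMk_nhds (hB'.comp hφ.tendsto_atTop)).prodMk_nhds hq)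
    (Eventually.of_forall fun m => hp (φ m))

end RankOne

section FiniteRank

variable {H : Type*} [NormedAddCommGroup H] [InnerProductSpace ℂ H] {d : ℕ}

/-- The real matrix identity is read in the orthonormal system `e`: columns of `Q` give the new
eigenvectors and `y` gives `ψ`. -/
theorem exists_rank_one_update {e : Fin d → H} (he : Orthonormal ℂ e) {a b : Fin d → ℝ}
    (h1 : ∀ i, a i ≤ b i) (h2 : ∀ i j, i < j → b j ≤ a i) :
    ∃ (v : Fin d → H) (ψ : H), Orthonormal ℂ v ∧
      (∀ i, v i ∈ Submodule.span ℂ (Set.range e)) ∧ ψ ∈ Submodule.span ℂ (Set.range e) ∧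
      ∀ w, ∑ i, ((a i : ℂ) * inner ℂ (e i) w) • e i + inner ℂ ψ w • ψ =
        ∑ i, ((b i : ℂ) * inner ℂ (v i) w) • v i := by
  obtain ⟨y, Q, hQ, hy⟩ := exists_isRankOneUpdate h1 h2
  refine ⟨fun l => ∑ i, (Q i l : ℂ) • e i, ∑ i, (y i : ℂ) • e i, ?_, fun l => ?_, ?_, fun w => ?_⟩
  · rw [orthonormal_iff_ite]
    intro l m
    rw [he.inner_sum]
    simp only [Complex.conj_ofReal]
    have := congrArg (fun t : ℝ => (t : ℂ)) (hQ l m)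
    push_cast at this
    rw [this]
    split_ifs <;> simp
  · exact Submodule.sum_mem _ fun i _ => Submodule.smul_mem _ _ (Submodule.subset_span ⟨i, rfl⟩)
  · exact Submodule.sum_mem _ fun i _ => Submodule.smul_mem _ _ (Submodule.subset_span ⟨i, rfl⟩)
  · have hsum : ∀ c : Fin d → ℝ, inner ℂ (∑ i, (c i : ℂ) • e i) w =
        ∑ i, (c i : ℂ) * inner ℂ (e i) w := fun c => by
      rw [sum_inner]
      exact Finset.sum_congr rfl fun i _ => by rw [inner_smul_left, Complex.conj_ofReal]
    have hL : ∑ i, ((a i : ℂ) * inner ℂ (e i) w) • e i +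
        inner ℂ (∑ i, (y i : ℂ) • e i) w • ∑ i, (y i : ℂ) • e i =
        ∑ j, ∑ i, ((((if i = j then a i else 0) + y i * y j : ℝ) : ℂ) * inner ℂ (e i) w) • e j := by
      rw [hsum, Finset.smul_sum, ← Finset.sum_add_distrib]
      refine Finset.sum_congr rfl fun j _ => ?_
      rw [smul_smul, ← add_smul, ← Finset.sum_smul]
      congr 1
      push_cast
      simp only [add_mul, Finset.sum_add_distrib, Finset.sum_mul]
      congr 1
      · rw [Finset.sum_eq_single j (fun i _ hij => by simp [hij]) (by simp)]
        simp
      exact Finset.sum_congr rfl fun i _ => by ring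
    have hRR : ∑ l, ((b l : ℂ) * inner ℂ (∑ i, (Q i l : ℂ) • e i) w) • ∑ j, (Q j l : ℂ) • e j =
        ∑ j, ∑ i, (((∑ l, Q i l * b l * Q j l : ℝ) : ℂ) * inner ℂ (e i) w) • e j := by
      simp only [hsum, Finset.smul_sum]
      rw [Finset.sum_comm]
      refine Finset.sum_congr rfl fun j _ => ?_
      simp only [smul_smul]
      rw [← Finset.sum_smul, ← Finset.sum_smul]
      congr 1
      push_cast
      simp only [Finset.mul_sum, Finset.sum_mul]
      rw [Finset.sum_comm]
      exact Finset.sum_congr rfl fun i _ => Finset.sum_congr rfl fun l _ => by ring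
    rw [hL, hRR]
    simp only [hy]

/-- Each induction step spends one rank one update to move from `a` to an intermediate sequence `c`,
from which `b` is reachable with `r` further updates. -/
theorem exists_finite_rank_update (r : ℕ) : ∀ {e : Fin d → H}, Orthonormal ℂ e →
    ∀ {a b : ℕ → ℝ}, Antitone a → Antitone b → (∀ i, a i ≤ b i) → (∀ i, b (i + r) ≤ a i) →
    ∃ (v : Fin d → H) (ψ : Fin r → H), Orthonormal ℂ v ∧
      (∀ i, v i ∈ Submodule.span ℂ (Set.range e)) ∧
      (∀ j, ψ j ∈ Submodule.span ℂ (Set.range e)) ∧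
      ∀ w, ∑ i : Fin d, ((a i : ℂ) * inner ℂ (e i) w) • e i + ∑ j, inner ℂ (ψ j) w • ψ j =
        ∑ i : Fin d, ((b i : ℂ) * inner ℂ (v i) w) • v i := by
  induction r with
  | zero =>
    intro e he a b ha hb h1 h2
    refine ⟨e, Fin.elim0, he, fun i => Submodule.subset_span ⟨i, rfl⟩, fun j => j.elim0,
      fun w => ?_⟩
    have : ∀ i, a i = b i := fun i => le_antisymm (h1 i) (h2 i)
    simp [this]
  | succ r ih =>
    intro e he a b ha hb h1 h2
    -- The largest sequence below `b` that a rank one update of `a` can reach, that is, with `c (i +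
    -- 1) ≤ a i`.
    set c : ℕ → ℝ := fun i => Nat.casesOn i (b 0) fun i => min (b (i + 1)) (a i) with hc
    have hc0 : c 0 = b 0 := rfl
    have hcs : ∀ i, c (i + 1) = min (b (i + 1)) (a i) := fun i => rfl
    have hac : ∀ i, a i ≤ c i := by
      rintro (_ | i)
      · exact h1 0
      · exact le_min (h1 _) (ha (Nat.le_succ i))
    have hcanti : Antitone c := by
      refine antitone_nat_of_succ_le ?_
      rintro (_ | i)
      · rw [hcs, hc0]; exact (min_le_left _ _).trans (hb (Nat.zero_le _))
      · rw [hcs, hcs]; exact min_le_min (hb (Nat.le_succ _)) (ha (Nat.le_succ _))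
    obtain ⟨v, ψ, hv, hve, hψ, heq⟩ := exists_rank_one_update he (a := fun i => a i)
      (b := fun i => c i) (fun i => hac i) (fun i j hij => by
        have h3 : c j ≤ c ((i : ℕ) + 1) := hcanti (by exact_mod_cast hij)
        exact h3.trans (min_le_right _ _))
    obtain ⟨u, χ, hu, huv, hχ, heq'⟩ := ih hv hcanti hb
      (by
        rintro (_ | i)
        · exact le_rfl
        · exact min_le_left _ _)
      (by
        rintro (_ | i)
        · exact hb (Nat.zero_le _)
        · refine le_min (hb (by omega)) ?_
          have := h2 i
          rwa [show i + (r + 1) = i + 1 + r by omega] at this)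
    have hle : Submodule.span ℂ (Set.range v) ≤ Submodule.span ℂ (Set.range e) := by
      rw [Submodule.span_le]
      rintro _ ⟨i, rfl⟩
      exact hve i
    refine ⟨u, Fin.cons ψ χ, hu, fun i => hle (huv i), fun j => ?_, fun w => ?_⟩
    · refine Fin.cases ?_ (fun j => ?_) j
      · exact hψ
      · exact hle (hχ j)
    · rw [← heq', ← heq, Fin.sum_univ_succ, add_assoc]
      simp only [Fin.cons_zero, Fin.cons_succ]

end FiniteRank

end

section

/-! ### Measurable selections -/

section Selection

variable {P Y : Type*} [TopologicalSpace P]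

theorem isClosed_image_fst_of_compactSpace [TopologicalSpace Y] [CompactSpace Y] {K : Set (P × Y)}
    (hK : IsClosed K) : IsClosed {p | ∃ y, (p, y) ∈ K} := by
  have := isClosedMap_fst_of_compactSpace (X := P) (Y := Y) K hK
  convert this using 1
  ext p
  simp

variable [MeasurableSpace P] [BorelSpace P]

open Classical in
-- `Y` is a continuous image of the Cantor set, which lies in `ℝ`, so the least admissible parameter
-- can be selected. Its sublevel sets are projections of closed sets along a compact factor, hence
-- closed, up to the default value off the domain.
theorem exists_measurable_selection_of_compact [MetricSpace Y] [CompactSpace Y] [MeasurableSpace Y]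
    [BorelSpace Y] [Nonempty Y] {K : Set (P × Y)} (hK : IsClosed K) :
    ∃ s : P → Y, Measurable s ∧ ∀ p, (∃ y, (p, y) ∈ K) → (p, s p) ∈ K := by
  obtain ⟨φ, hφ, hφs⟩ := exists_nat_bool_continuous_surjective_of_compact Y
  have : CompactSpace cantorSet := isCompact_iff_compactSpace.1 isCompact_cantorSet
  set θ : cantorSet → Y := φ ∘ cantorSetHomeomorphNatToBool with hθ
  have hθc : Continuous θ := hφ.comp cantorSetHomeomorphNatToBool.continuous
  have hθs : Function.Surjective θ := hφs.comp cantorSetHomeomorphNatToBool.surjective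
  set K' : Set (P × cantorSet) := {q | (q.1, θ q.2) ∈ K} with hK'
  have hK'c : IsClosed K' := hK.preimage (continuous_fst.prodMk (hθc.comp continuous_snd))
  have hmin : ∀ p, (∃ t, (p, t) ∈ K') → ∃ t, (p, t) ∈ K' ∧ ∀ t', (p, t') ∈ K' → t.1 ≤ t'.1 := by
    intro p hp
    have hc : IsCompact {t | (p, t) ∈ K'} := (hK'c.preimage (Continuous.prodMk_right p)).isCompact
    obtain ⟨t, ht, hmin⟩ := hc.exists_isMinOn hp continuous_subtype_val.continuousOn
    exact ⟨t, ht, fun t' ht' => hmin ht'⟩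
  set c : P → cantorSet := fun p =>
    if hp : ∃ t, (p, t) ∈ K' then (hmin p hp).choose else ⟨0, zero_mem_cantorSet⟩ with hc
  have hcK : ∀ p, (∃ t, (p, t) ∈ K') → (p, c p) ∈ K' ∧ ∀ t', (p, t') ∈ K' → (c p).1 ≤ t'.1 := by
    intro p hp
    simp only [hc, dif_pos hp]
    exact (hmin p hp).choose_spec
  have hD : MeasurableSet {p | ∃ t, (p, t) ∈ K'} :=
    (isClosed_image_fst_of_compactSpace hK'c).measurableSet
  have hcm : Measurable c := by
    refine (MeasurableEmbedding.subtype_coe isClosed_cantorSet.measurableSet).measurable_comp_iff.1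
      (measurable_of_Iic fun a => ?_)
    have hDa : MeasurableSet {p | ∃ t, (p, t) ∈ K' ∩ {q : P × cantorSet | q.2.1 ≤ a}} :=
      (isClosed_image_fst_of_compactSpace (hK'c.inter (isClosed_le
        (continuous_subtype_val.comp continuous_snd) continuous_const))).measurableSet
    -- The second piece collects the points without admissible parameter, where `c` has the default
    -- value `0`.
    have e : (Subtype.val ∘ c) ⁻¹' Set.Iic a =
        {p | ∃ t, (p, t) ∈ K' ∩ {q : P × cantorSet | q.2.1 ≤ a}} ∪
          ({p | ∃ t, (p, t) ∈ K'}ᶜ ∩ {_p | (0 : ℝ) ≤ a}) := by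
      ext p
      by_cases hp : ∃ t, (p, t) ∈ K'
      · have h1 := hcK p hp
        constructor
        · exact fun h => Or.inl ⟨c p, h1.1, h⟩
        · rintro (⟨t, ht, hta⟩ | h)
          · exact (h1.2 t ht).trans hta
          · exact absurd hp h.1
      · have h1 : c p = ⟨0, zero_mem_cantorSet⟩ := by simp only [hc, dif_neg hp]
        constructor
        · intro h
          refine Or.inr ⟨hp, ?_⟩
          have h2 : (c p).1 ≤ a := h
          rwa [h1] at h2
        · rintro (⟨t, ht, -⟩ | h)
          · exact absurd ⟨t, ht⟩ hp
          · have h2 : (c p).1 ≤ a := by rw [h1]; exact h.2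
            exact h2
    rw [e]
    exact hDa.union (hD.compl.inter (MeasurableSet.const _))
  refine ⟨θ ∘ c, hθc.measurable.comp hcm, fun p hp => ?_⟩
  obtain ⟨y, hy⟩ := hp
  obtain ⟨t, rfl⟩ := hθs y
  exact (hcK p ⟨t, hy⟩).1

open Classical in
/-- A closed relation with values in a proper metric space has a measurable selection. -/
theorem exists_measurable_selection [MetricSpace Y] [ProperSpace Y] [MeasurableSpace Y]
    [BorelSpace Y] [Nonempty Y] {K : Set (P × Y)} (hK : IsClosed K) :
    ∃ s : P → Y, Measurable s ∧ ∀ p, (∃ y, (p, y) ∈ K) → (p, s p) ∈ K := by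
  obtain ⟨y₀⟩ := ‹Nonempty Y›
  have hcomp : ∀ N : ℕ, CompactSpace (Metric.closedBall y₀ (N : ℝ)) := fun N =>
    isCompact_iff_compactSpace.1 (isCompact_closedBall _ _)
  have hne : ∀ N : ℕ, Nonempty (Metric.closedBall y₀ (N : ℝ)) := fun N =>
    ⟨⟨y₀, Metric.mem_closedBall_self N.cast_nonneg⟩⟩
  have hKN : ∀ N : ℕ, IsClosed {q : P × Metric.closedBall y₀ (N : ℝ) | (q.1, (q.2 : Y)) ∈ K} :=
    fun N => hK.preimage (continuous_fst.prodMk (continuous_subtype_val.comp continuous_snd))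
  choose s hs hsK using fun N => exists_measurable_selection_of_compact (hKN N)
  set D : ℕ → Set P := fun N => {p | ∃ y : Metric.closedBall y₀ (N : ℝ), (p, (y : Y)) ∈ K} with hD
  have hDm : ∀ N, MeasurableSet (D N) := fun N =>
    (isClosed_image_fst_of_compactSpace (hKN N)).measurableSet
  -- `D N` are the points solvable in the ball of radius `N`; the second alternative makes
  -- `Nat.find` total.
  have hex : ∀ p, ∃ N, p ∈ D N ∨ p ∉ ⋃ N, D N := by
    intro p
    by_cases hp : p ∈ ⋃ N, D N
    · obtain ⟨N, hN⟩ := Set.mem_iUnion.1 hp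
      exact ⟨N, Or.inl hN⟩
    · exact ⟨0, Or.inr hp⟩
  refine ⟨fun p => (s (Nat.find (hex p)) p : Y), ?_, fun p hp => ?_⟩
  · exact Measurable.find (f := fun N p => (s N p : Y))
      (p := fun N p => p ∈ D N ∨ p ∉ ⋃ N, D N) (fun N => measurable_subtype_coe.comp (hs N))
      (fun N => (hDm N).union (MeasurableSet.iUnion hDm).compl) hex
  · obtain ⟨y, hy⟩ := hp
    obtain ⟨N, hN⟩ := exists_nat_ge (dist y y₀)
    have hpU : p ∈ ⋃ N, D N := Set.mem_iUnion.2 ⟨N, ⟨y, Metric.mem_closedBall.2 hN⟩, hy⟩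
    have hmem := (Nat.find_spec (hex p)).resolve_right (not_not.2 hpU)
    exact hsK _ p hmem

end Selection

/-! ### Completions of a finite family, expressed through its Gram matrix -/

section Completion

variable {n : ℕ}

/-- Let `G` be the Gram matrix of `γ`, and put `v i = ∑ a, U a i • γ a`, `ψ j = ∑ a, Z a j • γ a`.
The relation says that the first `d` vectors of `v` are orthonormal and the other ones zero, that
`ψ j = 0` for `j ≥ n - d`, and that `∑ γ γ* + ∑ ψ ψ* = ∑ m v v*` on the span of `γ`. -/
def IsCompletion (d : ℕ) (G : Fin n → Fin n → ℂ) (m : Fin n → ℝ) (U Z : Fin n → Fin n → ℂ) :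
    Prop :=
  (∀ i j, ∑ a, ∑ b, star (U a i) * (G a b * U b j) = if i = j ∧ (i : ℕ) < d then 1 else 0) ∧
  (∀ i : Fin n, d ≤ i → m i = 0) ∧ (∀ a, ∀ j : Fin n, n ≤ j + d → Z a j = 0) ∧
  ∀ p q, ∑ r, G p r * star (G q r) + ∑ j, (∑ a, G p a * Z a j) * star (∑ a, G q a * Z a j) =
    ∑ i, (m i : ℂ) * ((∑ a, G p a * U a i) * star (∑ a, G q a * U a i))

/-- The relation is a finite union over `d` of closed sets. Only `(U, Z)` is selected, so the `d` in
the conclusion is not tied to the given one; `IsCompletion.finrank_span_le` later supplies what is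
needed about it. -/
theorem exists_measurable_completion (n : ℕ) :
    ∃ s : (Fin n → Fin n → ℂ) × (Fin n → ℝ) → (Fin n → Fin n → ℂ) × (Fin n → Fin n → ℂ),
      Measurable s ∧ ∀ p, (∃ d ≤ n, ∃ U Z, IsCompletion d p.1 p.2 U Z) →
        ∃ d ≤ n, IsCompletion d p.1 p.2 (s p).1 (s p).2 := by
  have hcl : IsClosed {q : ((Fin n → Fin n → ℂ) × (Fin n → ℝ)) ×
      ((Fin n → Fin n → ℂ) × (Fin n → Fin n → ℂ)) |
        ∃ d : Fin (n + 1), IsCompletion d q.1.1 q.1.2 q.2.1 q.2.2} := by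
    rw [Set.ofPred_exists]
    refine isClosed_iUnion_of_finite fun d => ?_
    simp only [IsCompletion, Set.ofPred_and, Set.ofPred_forall]
    refine IsClosed.inter ?_ (IsClosed.inter ?_ (IsClosed.inter ?_ ?_))
    · exact isClosed_iInter fun i => isClosed_iInter fun j => isClosed_eq (by fun_prop) (by fun_prop)
    · exact isClosed_iInter fun i => isClosed_iInter fun _ => isClosed_eq (by fun_prop) (by fun_prop)
    · exact isClosed_iInter fun a => isClosed_iInter fun j => isClosed_iInter fun _ =>
        isClosed_eq (by fun_prop) (by fun_prop)
    · exact isClosed_iInter fun i => isClosed_iInter fun j => isClosed_eq (by fun_prop) (by fun_prop)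
  obtain ⟨s, hs, hsK⟩ := exists_measurable_selection hcl
  refine ⟨s, hs, fun p hp => ?_⟩
  obtain ⟨d, hd, U, Z, h⟩ := hp
  obtain ⟨d', h'⟩ := hsK p ⟨(U, Z), ⟨d, Nat.lt_succ_of_le hd⟩, h⟩
  exact ⟨d', Nat.le_of_lt_succ d'.2, h'⟩

variable {H : Type*} [NormedAddCommGroup H] [InnerProductSpace ℂ H]

/-- The family `(∑ a, U a i • γ a)_i`. -/
def combine (U : Fin n → Fin n → ℂ) (γ : Fin n → H) (i : Fin n) : H := ∑ a, U a i • γ a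

theorem inner_combine (U : Fin n → Fin n → ℂ) (γ : Fin n → H) (x : H) (i : Fin n) :
    inner ℂ x (combine U γ i) = ∑ a, inner ℂ x (γ a) * U a i := by
  rw [combine, inner_sum]
  exact Finset.sum_congr rfl fun a _ => by rw [inner_smul_right, mul_comm]

theorem inner_combine_combine (U : Fin n → Fin n → ℂ) (γ : Fin n → H) (i j : Fin n) :
    inner ℂ (combine U γ i) (combine U γ j) =
      ∑ a, ∑ b, star (U a i) * (inner ℂ (γ a) (γ b) * U b j) := by
  conv_lhs => rw [combine, sum_inner]
  refine Finset.sum_congr rfl fun a _ => ?_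
  rw [inner_smul_left, inner_combine, Finset.mul_sum]
  rfl

theorem combine_mem_span (U : Fin n → Fin n → ℂ) (γ : Fin n → H) (i : Fin n) :
    combine U γ i ∈ Submodule.span ℂ (Set.range γ) :=
  Submodule.sum_mem _ fun a _ => Submodule.smul_mem _ _ (Submodule.subset_span ⟨a, rfl⟩)

theorem inner_rankSum (a b : Fin n → H) (x w : H) :
    inner ℂ x (rankSum a b w) = ∑ i, inner ℂ x (b i) * star (inner ℂ w (a i)) := by
  rw [rankSum_apply, inner_sum]
  refine Finset.sum_congr rfl fun i _ => ?_
  rw [inner_smul_right, mul_comm, ← inner_conj_symm (a i)]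
  rfl

theorem rankSum_self_isPositive (a : Fin n → H) : (rankSum a a).IsPositive := by
  have key : ∀ x, inner ℂ (rankSum a a x) x = ((∑ i, ‖inner ℂ (a i) x‖ ^ 2 : ℝ) : ℂ) := by
    intro x
    rw [rankSum_apply, sum_inner]
    push_cast
    refine Finset.sum_congr rfl fun i _ => ?_
    rw [inner_smul_left, Complex.conj_mul']
  rw [ContinuousLinearMap.isPositive_def]
  refine ⟨(LinearMap.isSymmetric_iff_inner_map_self_real _).2 fun x => ?_, fun x => ?_⟩
  · have := key x
    change (starRingEnd ℂ) (inner ℂ (rankSum a a x) x) = inner ℂ (rankSum a a x) x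
    rw [this, Complex.conj_ofReal]
  · rw [ContinuousLinearMap.reApplyInnerSelf_apply, key]
    change 0 ≤ (((∑ i, ‖inner ℂ (a i) x‖ ^ 2 : ℝ) : ℂ)).re
    rw [Complex.ofReal_re]
    positivity

theorem re_inner_rankSum_self (a : Fin n → H) (x : H) :
    (inner ℂ x (rankSum a a x)).re = ∑ i, ‖inner ℂ (a i) x‖ ^ 2 := by
  rw [inner_rankSum, Complex.re_sum]
  refine Finset.sum_congr rfl fun i _ => ?_
  rw [Complex.star_def, Complex.mul_conj', norm_inner_symm]
  norm_cast

/-- Completions solve the operator identity on the whole space. -/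
theorem IsCompletion.apply {d : ℕ} {γ : Fin n → H} {m : Fin n → ℝ} {U Z : Fin n → Fin n → ℂ}
    (h : IsCompletion d (fun a b => inner ℂ (γ a) (γ b)) m U Z) (w : H) :
    rankSum γ γ w + rankSum (combine Z γ) (combine Z γ) w =
      ∑ i, ((m i : ℂ) * inner ℂ (combine U γ i) w) • combine U γ i := by
  set v := combine U γ with hv
  set ψ := combine Z γ with hψ
  set J := Submodule.span ℂ (Set.range γ) with hJ
  set C : H →L[ℂ] H := rankSum v fun i => (m i : ℂ) • v i with hC
  -- `X` is self-adjoint with range in `J`. The completion equations say `⟨γ p, X (γ q)⟩ = 0`, so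
  -- `X` kills every `γ q`, and self-adjointness then gives `X = 0` everywhere.
  set X : H →L[ℂ] H := rankSum γ γ + rankSum ψ ψ - C with hX
  have hXs : ∀ x y, inner ℂ x (X y) = star (inner ℂ y (X x)) := by
    intro x y
    simp only [hX, hC, sub_apply, add_apply, inner_sub_right,
      inner_add_right, inner_rankSum, star_sub, star_add, star_sum, star_mul, star_star,
      inner_smul_right]
    congr 1
    refine Finset.sum_congr rfl fun i _ => ?_
    rw [Complex.star_def, Complex.conj_ofReal]
    ring
  have hXJ : ∀ x, X x ∈ J := by
    intro x
    simp only [hX, hC, sub_apply, add_apply, rankSum_apply]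
    refine J.sub_mem (J.add_mem ?_ ?_) ?_ <;> refine Submodule.sum_mem _ fun i _ => J.smul_mem _ ?_
    · exact Submodule.subset_span ⟨i, rfl⟩
    · exact combine_mem_span _ _ _
    · exact J.smul_mem _ (combine_mem_span _ _ _)
  have hγX : ∀ p q, inner ℂ (γ p) (X (γ q)) = 0 := by
    intro p q
    have := h.2.2.2 p q
    simp only [hX, hC, sub_apply, add_apply, inner_sub_right, inner_add_right, inner_rankSum,
      inner_smul_right, hv, hψ, inner_combine]
    rw [this, sub_eq_zero]
    exact Finset.sum_congr rfl fun i _ => by rw [mul_assoc]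
  have hperp : ∀ y, (∀ p, inner ℂ (γ p) y = 0) → ∀ c ∈ J, inner ℂ c y = 0 := by
    intro y hy c hc
    have hle : J ≤ (ℂ ∙ y)ᗮ := by
      rw [hJ, Submodule.span_le]
      rintro _ ⟨i, rfl⟩
      exact Submodule.mem_orthogonal_singleton_iff_inner_left.2 (hy i)
    exact Submodule.mem_orthogonal_singleton_iff_inner_left.1 (hle hc)
  have hXγ : ∀ q, X (γ q) = 0 := fun q =>
    inner_self_eq_zero.1 (hperp _ (fun p => hγX p q) _ (hXJ _))
  have hX0 : X w = 0 := by
    refine inner_self_eq_zero.1 (hperp _ (fun p => ?_) _ (hXJ _))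
    rw [hXs, hXγ, inner_zero_right, star_zero]
  have : rankSum γ γ w + rankSum ψ ψ w = C w := by
    rw [← sub_eq_zero]; exact hX0
  rw [this, hC, rankSum_apply]
  exact Finset.sum_congr rfl fun i _ => by rw [smul_smul, mul_comm]

theorem IsCompletion.isTruncatedOrthonormal {d : ℕ} {γ : Fin n → H} {m : Fin n → ℝ}
    {U Z : Fin n → Fin n → ℂ} (h : IsCompletion d (fun a b => inner ℂ (γ a) (γ b)) m U Z) :
    IsTruncatedOrthonormal d (combine U γ) := fun i j => by
  rw [inner_combine_combine, h.1]

theorem IsCompletion.combine_eq_zero {d : ℕ} {γ : Fin n → H} {m : Fin n → ℝ}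
    {U Z : Fin n → Fin n → ℂ} (h : IsCompletion d (fun a b => inner ℂ (γ a) (γ b)) m U Z)
    {j : Fin n} (hj : n ≤ j + d) : combine Z γ j = 0 :=
  Finset.sum_eq_zero fun a _ => by rw [h.2.2.1 a j hj, zero_smul]

theorem rank_rankSum_le {r : ℕ} (a b : Fin n → H) (hb : ∀ j : Fin n, r ≤ j → b j = 0) :
    LinearMap.rank (rankSum a b : H →ₗ[ℂ] H) ≤ r := by
  have hle : LinearMap.range (rankSum a b : H →ₗ[ℂ] H) ≤
      Submodule.span ℂ (Set.range fun j : {j : Fin n // (j : ℕ) < r} => b j.1) := by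
    rintro _ ⟨w, rfl⟩
    change rankSum a b w ∈ _
    rw [rankSum_apply]
    refine Submodule.sum_mem _ fun j _ => ?_
    by_cases hj : (j : ℕ) < r
    · exact Submodule.smul_mem _ _ (Submodule.subset_span ⟨⟨j, hj⟩, rfl⟩)
    · rw [hb j (not_lt.1 hj), smul_zero]; exact Submodule.zero_mem _
  have hfin := FiniteDimensional.span_of_finite ℂ
    (Set.finite_range fun j : {j : Fin n // (j : ℕ) < r} => b j.1)
  refine (Submodule.rank_mono hle).trans ?_
  rw [← Module.finrank_eq_rank]
  have : Fintype.card {j : Fin n // (j : ℕ) < r} ≤ r := by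
    have := Fintype.card_le_of_injective (fun j : {j : Fin n // (j : ℕ) < r} => (⟨j.1, j.2⟩ : Fin r))
      (fun i j hij => by
        apply Subtype.ext; apply Fin.ext
        simpa using hij)
    simpa using this
  exact_mod_cast (finrank_range_le_card _).trans this

/-- A vector orthogonal to the first `d` vectors of `combine U γ` is killed by the right side of
`IsCompletion.apply`, hence by a sum of two positive operators, so it is orthogonal to every `γ p`.
This makes the bound `n - d` on the rank of the perturbation sufficient. -/
theorem IsCompletion.finrank_span_le {d : ℕ} {γ : Fin n → H} {m : Fin n → ℝ}
    {U Z : Fin n → Fin n → ℂ} (h : IsCompletion d (fun a b => inner ℂ (γ a) (γ b)) m U Z) :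
    Module.finrank ℂ (Submodule.span ℂ (Set.range γ)) ≤ d := by
  set v := combine U γ with hv
  set K := Submodule.span ℂ (Set.range fun j : {j : Fin n // (j : ℕ) < d} => v j.1) with hK
  have hfin : FiniteDimensional ℂ K := FiniteDimensional.span_of_finite ℂ (Set.finite_range _)
  have hv0 : ∀ i : Fin n, d ≤ i → v i = 0 := fun i hi => by
    rw [← inner_self_eq_zero (𝕜 := ℂ), h.isTruncatedOrthonormal]
    simp [not_lt.2 hi]
  have hle : Submodule.span ℂ (Set.range γ) ≤ K := by
    rw [Submodule.span_le]
    rintro _ ⟨p, rfl⟩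
    rw [← K.orthogonal_orthogonal]
    refine (Submodule.mem_orthogonal _ _).2 fun w hw => ?_
    have hvw : ∀ i, inner ℂ (v i) w = 0 := by
      intro i
      by_cases hi : (i : ℕ) < d
      · exact hw _ (Submodule.subset_span ⟨⟨i, hi⟩, rfl⟩)
      · rw [hv0 i (not_lt.1 hi), inner_zero_left]
    have h1 := h.apply w
    simp only [← hv, hvw, mul_zero, zero_smul, Finset.sum_const_zero] at h1
    have h2 := congrArg (fun z => (inner ℂ w z).re) h1
    simp only [inner_add_right, Complex.add_re, re_inner_rankSum_self, inner_zero_right,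
      Complex.zero_re] at h2
    have h3 : ∑ i, ‖inner ℂ (γ i) w‖ ^ 2 = 0 := by
      have e1 : 0 ≤ ∑ i, ‖inner ℂ (γ i) w‖ ^ 2 := by positivity
      have e2 : 0 ≤ ∑ i, ‖inner ℂ (combine Z γ i) w‖ ^ 2 := by positivity
      linarith
    have h4 := (Finset.sum_eq_zero_iff_of_nonneg fun i _ => by positivity).1 h3 p (Finset.mem_univ p)
    have h5 : inner ℂ (γ p) w = 0 := by simpa using h4
    rw [← inner_conj_symm, h5, map_zero]
  refine (Submodule.finrank_mono hle).trans ?_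
  refine (finrank_range_le_card _).trans ?_
  have := Fintype.card_le_of_injective (fun j : {j : Fin n // (j : ℕ) < d} => (⟨j.1, j.2⟩ : Fin d))
      (fun i j hij => by
        apply Subtype.ext; apply Fin.ext
        simpa using hij)
  simpa using this

end Completion

end

section

/-! ### Eigenvalues of completions at a point -/

theorem sum_fin_eq_of_le {M : Type*} [AddCommMonoid M] {d n : ℕ} (hd : d ≤ n) {F : Fin n → M}
    {f : Fin d → M} (h1 : ∀ i : Fin d, F (Fin.castLE hd i) = f i)
    (h2 : ∀ i : Fin n, d ≤ i → F i = 0) : ∑ i, F i = ∑ i, f i := by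
  obtain ⟨r, rfl⟩ := Nat.exists_eq_add_of_le hd
  rw [Fin.sum_univ_add, Finset.sum_eq_zero (f := fun i => F (Fin.natAdd d i))
    fun i _ => h2 _ (by simp), add_zero]
  exact Finset.sum_congr rfl fun i _ => h1 i

section Pointwise

variable {H : Type*} [NormedAddCommGroup H] [InnerProductSpace ℂ H] {n : ℕ}

theorem exists_coeff_of_mem_span {γ : Fin n → H} {d : ℕ} {v : Fin d → H} (hd : d ≤ n)
    (hv : ∀ i, v i ∈ Submodule.span ℂ (Set.range γ)) :
    ∃ U : Fin n → Fin n → ℂ, (∀ i, combine U γ (Fin.castLE hd i) = v i) ∧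
      ∀ a, ∀ i : Fin n, d ≤ i → U a i = 0 := by
  choose c hc using fun i => (Submodule.mem_span_range_iff_exists_fun ℂ).1 (hv i)
  refine ⟨fun a i => if h : (i : ℕ) < d then c ⟨i, h⟩ a else 0, fun i => ?_, fun a i hi => ?_⟩
  · rw [← hc i, combine]
    simp
  · exact dif_neg (not_lt.2 hi)

/-- Eigenvalues which interlace the ones of `∑ γ γ*` are realized by a completion. -/
theorem exists_isCompletion {γ : Fin n → H} {d : ℕ} (hd : d ≤ n) {e : Fin d → H} {lam mu : ℕ → ℝ}
    (hs : IsSpectral (rankSum γ γ) d e lam) (he : ∀ i, e i ∈ Submodule.span ℂ (Set.range γ))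
    (hmu : Antitone mu) (hmu0 : ∀ i, d ≤ i → mu i = 0) (h1 : ∀ i < d, lam i ≤ mu i)
    (h2 : ∀ i, mu (i + (n - d)) ≤ lam i) :
    ∃ U Z, IsCompletion d (fun a b => inner ℂ (γ a) (γ b)) (fun i : Fin n => mu i) U Z := by
  have heo : Orthonormal ℂ e := by
    have := hs.orthonormal.orthonormal_comp (f := id) Function.injective_id fun i => i.2
    simpa using this
  obtain ⟨v, ψ, hv, hve, hψe, heq⟩ := exists_finite_rank_update (n - d) heo hs.antitone hmu
    (fun i => by
      by_cases hi : i < d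
      · exact h1 i hi
      · rw [hs.eq_zero i (not_lt.1 hi), hmu0 i (not_lt.1 hi)]) h2
  have hle : Submodule.span ℂ (Set.range e) ≤ Submodule.span ℂ (Set.range γ) := by
    rw [Submodule.span_le]
    rintro _ ⟨i, rfl⟩
    exact he i
  obtain ⟨U, hU, hU0⟩ := exists_coeff_of_mem_span hd fun i => hle (hve i)
  obtain ⟨Z, hZ, hZ0⟩ := exists_coeff_of_mem_span (n.sub_le d) fun i => hle (hψe i)
  have hv0 : ∀ i : Fin n, d ≤ i → combine U γ i = 0 := fun i hi =>
    Finset.sum_eq_zero fun a _ => by rw [hU0 a i hi, zero_smul]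
  have hψ0 : ∀ i : Fin n, n - d ≤ i → combine Z γ i = 0 := fun i hi =>
    Finset.sum_eq_zero fun a _ => by rw [hZ0 a i hi, zero_smul]
  refine ⟨U, Z, fun i j => ?_, fun i hi => hmu0 i hi, fun a j hj => hZ0 a j (by omega),
    fun p q => ?_⟩
  · rw [← inner_combine_combine]
    by_cases hi : (i : ℕ) < d
    · by_cases hj : (j : ℕ) < d
      · have e1 : i = Fin.castLE hd ⟨i, hi⟩ := rfl
        have e2 : j = Fin.castLE hd ⟨j, hj⟩ := rfl
        rw [e1, e2, hU, hU, orthonormal_iff_ite.1 hv]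
        simp [hi, Fin.ext_iff]
      · rw [hv0 j (not_lt.1 hj), inner_zero_right, if_neg]
        rintro ⟨rfl, h⟩
        exact hj h
    · rw [hv0 i (not_lt.1 hi), inner_zero_left, if_neg fun h => hi h.2]
  · have h3 := congrArg (fun z => inner ℂ (γ p) z) (heq (γ q))
    simp only [← hs.apply, inner_add_right, inner_rankSum, inner_sum, inner_smul_right] at h3
    simp only [← inner_combine]
    rw [sum_fin_eq_of_le (n.sub_le d) (F := fun j => inner ℂ (γ p) (combine Z γ j) *
        star (inner ℂ (γ q) (combine Z γ j)))
      (f := fun j => inner ℂ (ψ j) (γ q) * inner ℂ (γ p) (ψ j)), h3,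
      sum_fin_eq_of_le hd (F := fun i : Fin n => (mu i : ℂ) * (inner ℂ (γ p) (combine U γ i) *
        star (inner ℂ (γ q) (combine U γ i))))
      (f := fun i : Fin d => (mu i : ℂ) * inner ℂ (v i) (γ q) * inner ℂ (γ p) (v i))]
    · intro i
      rw [hU, ← inner_conj_symm (v i)]
      simp only [Fin.val_castLE, Complex.star_def]
      ring
    · intro i hi
      rw [hv0 i hi, inner_zero_right, zero_mul, mul_zero]
    · intro i
      rw [hZ, ← inner_conj_symm (ψ i), mul_comm]
      rfl
    · intro i hi
      rw [hψ0 i hi, inner_zero_right, zero_mul]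

theorem IsCompletion.isSpectral {γ : Fin n → H} {d : ℕ} (hd : d ≤ n) {mu : ℕ → ℝ}
    {U Z : Fin n → Fin n → ℂ}
    (h : IsCompletion d (fun a b => inner ℂ (γ a) (γ b)) (fun i : Fin n => mu i) U Z)
    (hmu : Antitone mu) (hmu0 : ∀ i, 0 ≤ mu i) (hmun : ∀ i, n ≤ i → mu i = 0) :
    IsSpectral (rankSum γ γ + rankSum (combine Z γ) (combine Z γ)) d (combine U γ) mu where
  le := hd
  antitone := hmu
  nonneg := hmu0
  eq_zero i hi := by
    by_cases hin : i < n
    · exact h.2.1 ⟨i, hin⟩ hi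
    · exact hmun i (not_lt.1 hin)
  orthonormal := h.isTruncatedOrthonormal
  apply w := h.apply w

/-- For `w = combine Z γ j`, the `j`-th term alone contributes `‖w‖⁴` to the quadratic form of the
completed operator at `w`, which is at most `M ‖w‖²`. -/
theorem IsCompletion.norm_combine_sq_le {γ : Fin n → H} {d : ℕ} {m : Fin n → ℝ}
    {U Z : Fin n → Fin n → ℂ} (h : IsCompletion d (fun a b => inner ℂ (γ a) (γ b)) m U Z)
    {M : ℝ} (hM0 : 0 ≤ M) (hM : ∀ i, m i ≤ M) (j : Fin n) : ‖combine Z γ j‖ ^ 2 ≤ M := by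
  set w := combine Z γ j with hw
  have h1 := congrArg (fun z => (inner ℂ w z).re) (h.apply w)
  simp only [inner_add_right, Complex.add_re, re_inner_rankSum_self, inner_sum, inner_smul_right,
    Complex.re_sum] at h1
  have h2 : ‖w‖ ^ 2 * ‖w‖ ^ 2 ≤ ∑ i, ‖inner ℂ (combine Z γ i) w‖ ^ 2 := by
    have := Finset.single_le_sum (f := fun i => ‖inner ℂ (combine Z γ i) w‖ ^ 2)
      (fun i _ => by positivity) (Finset.mem_univ j)
    refine le_trans (le_of_eq ?_) this
    rw [← hw, inner_self_eq_norm_sq_to_K, norm_pow, RCLike.norm_ofReal, abs_norm]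
    ring
  have h3 : ∑ i, ((m i : ℂ) * inner ℂ (combine U γ i) w * inner ℂ w (combine U γ i)).re ≤
      M * ‖w‖ ^ 2 := by
    calc _ ≤ ∑ i, M * ‖inner ℂ (combine U γ i) w‖ ^ 2 := by
          refine Finset.sum_le_sum fun i _ => ?_
          rw [← inner_conj_symm w, mul_assoc, Complex.mul_conj', Complex.re_ofReal_mul]
          have : ((‖inner ℂ (combine U γ i) w‖ : ℂ) ^ 2).re = ‖inner ℂ (combine U γ i) w‖ ^ 2 := by
            norm_cast
          rw [this]
          exact mul_le_mul_of_nonneg_right (hM i) (by positivity)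
      _ ≤ M * ‖w‖ ^ 2 := by
          rw [← Finset.mul_sum]
          exact mul_le_mul_of_nonneg_left (h.isTruncatedOrthonormal.sum_sq_le w) hM0
  have h4 : 0 ≤ ∑ i, ‖inner ℂ (γ i) w‖ ^ 2 := by positivity
  have h5 : ‖w‖ ^ 2 * ‖w‖ ^ 2 ≤ M * ‖w‖ ^ 2 := by linarith
  rcases (sq_nonneg ‖w‖).eq_or_lt with h6 | h6
  · rw [← h6]; exact hM0
  · exact le_of_mul_le_mul_right h5 h6

end Pointwise

/-- Weyl's inequalities for the perturbation of `∑ γ γ*` by a positive operator of small rank. -/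
theorem eigSeq_add {k n : ℕ} {γ : Fin n → Seq2 k} {B : Seq2 k →L[ℂ] Seq2 k} {d : ℕ}
    (hd : Module.finrank ℂ (Submodule.span ℂ (Set.range γ)) = d) (hB : B.IsPositive)
    (hBJ : ∀ w, B w ∈ Submodule.span ℂ (Set.range γ))
    (hr : LinearMap.rank (B : Seq2 k →ₗ[ℂ] Seq2 k) + (d : Cardinal) ≤ (n : Cardinal)) :
    (∀ i, d ≤ i → eigSeq (rankSum γ γ + B) i = 0) ∧
    (∀ i, eigSeq (rankSum γ γ) i ≤ eigSeq (rankSum γ γ + B) i) ∧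
    (∀ i, eigSeq (rankSum γ γ + B) (n - d + i) ≤ eigSeq (rankSum γ γ) i) ∧
    eigSeq (rankSum γ γ + B) 0 ≤ ‖rankSum γ γ + B‖ := by
  have hfin := FiniteDimensional.span_of_finite ℂ (Set.finite_range γ)
  have hγJ : ∀ w, rankSum γ γ w ∈ Submodule.span ℂ (Set.range γ) := fun w => by
    rw [rankSum_apply]
    exact Submodule.sum_mem _ fun i _ => Submodule.smul_mem _ _ (Submodule.subset_span ⟨i, rfl⟩)
  obtain ⟨e, lam, hlam, -⟩ := exists_isSpectral (rankSum_self_isPositive γ) hγJ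
  obtain ⟨v, mu, hmu, -⟩ := exists_isSpectral ((rankSum_self_isPositive γ).add hB)
    fun w => Submodule.add_mem _ (hγJ w) (hBJ w)
  subst hd
  simp only [eigSeq_eq hlam, eigSeq_eq hmu]
  refine ⟨hmu.eq_zero, hlam.mono hmu fun w => ?_, ?_, ?_⟩
  · rw [add_apply, inner_add_right, Complex.add_re]
    have := hB.re_inner_nonneg_right w
    exact le_add_of_nonneg_right this
  -- The rank, a cardinal at most `n`, is a natural number, and it is at most `n - d`.
  · obtain ⟨r, hrr⟩ := Cardinal.lt_aleph0.1
      ((le_self_add.trans hr).trans_lt (Cardinal.natCast_lt_aleph0))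
    rw [hrr] at hr
    rw [← Nat.cast_add, Nat.cast_le] at hr
    refine hlam.le_of_finrank_range_le hmu (B := B) (fun w => rfl) ?_
    rw [hrr]
    exact_mod_cast Nat.le_sub_of_add_le hr
  -- The top eigenvalue is bounded by a Rayleigh quotient, hence by the operator norm.
  · rcases (hmu.nonneg 0).eq_or_lt with h0 | h0
    · rw [← h0]; positivity
    · obtain ⟨W, _, hW, hT⟩ := hmu.exists_submodule h0
      have : Nontrivial W := Module.nontrivial_of_finrank_pos (R := ℂ) (by omega)
      obtain ⟨w, hw⟩ := exists_ne (0 : W)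
      have hw' : 0 < ‖(w : Seq2 k)‖ ^ 2 := by
        have : (w : Seq2 k) ≠ 0 := by simpa using hw
        positivity
      refine le_of_mul_le_mul_right ((hT w w.2).trans ?_) hw'
      refine (Complex.re_le_norm _).trans ((norm_inner_le_norm _ _).trans ?_)
      have := (rankSum γ γ + B).le_opNorm (w : Seq2 k)
      nlinarith [norm_nonneg (w : Seq2 k)]

end

section

/-! ### Eigenvalues of the fibers of the operators in `U_V(E(G))` -/

variable {k n : ℕ} {V : Submodule ℂ (L2 k)} {g : Fin n → L2 k}

/-- The eigenvalues of the fibers of `C ∈ U_V(E(G))` are essentially bounded and interlace the ones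
of the frame operator. -/
theorem eigSeq_fiber_of_mem_USet (hV : IsShiftInvariant V) (hg : IsFrameFor (translates g) V)
    {C : L2 k →L[ℂ] L2 k} (hC : C ∈ USet V g) :
    ∃ M : ℝ, ∀ᵐ x ∂(torusVol k), eigSeq (fiber C x) 0 ≤ M ∧
      (∀ i, dimFn V x ≤ i → eigSeq (fiber C x) i = 0) ∧
      (∀ i, eigSeq (fiber (frameOp (translates g)) x) i ≤ eigSeq (fiber C x) i) ∧
      ∀ i, eigSeq (fiber C x) (n - dimFn V x + i) ≤
        eigSeq (fiber (frameOp (translates g)) x) i := by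
  have := hV.1.completeSpace_coe
  obtain ⟨B, hB, hBsp, hBV, hBr, hCB⟩ := hC
  -- A self-adjoint operator with range in `V` vanishes on `Vᗮ`.
  have hB0 : ∀ w ∈ Vᗮ, B w = 0 := fun w hw => by
    rw [← inner_self_eq_zero (𝕜 := ℂ), hB.inner_left_eq_inner_right]
    exact inner_eq_zero_symm.1 (hw _ (hBV _))
  obtain ⟨ψ, hψV, hψ⟩ := exists_rankSum_isFiberField hV hg hBsp hBV hB0
  have hS := isFiberField_frameOp hg.isBessel
  have hsum := hS.add hψ
  rw [← hCB] at hsum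
  obtain ⟨M, hM⟩ := hsum.2.1
  refine ⟨M, ?_⟩
  filter_upwards [hM, hBr, hS.fiber_ae_eq, hψ.fiber_ae_eq, hsum.fiber_ae_eq, hψ.isPositive hB,
    rangeFn_eq_span hV hg, ae_all_iff.2 fun i => gam_mem_span hV hg (hψV i)]
    with x hMx hr h1 h2 h3 hpos hJ hψJ
  rw [h2] at hr
  rw [h1, h3]
  obtain ⟨c1, c2, c3, c4⟩ := eigSeq_add (n := n) (d := dimFn V x) (by rw [dimFn, hJ]) hpos
    (fun w => by
      rw [rankSum_apply]
      exact Submodule.sum_mem _ fun i _ => Submodule.smul_mem _ _ (hψJ i)) hr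
  exact ⟨c4.trans hMx, c1, c2, c3⟩

/-- Essentially bounded measurable sequences which interlace the eigenvalues of the frame operator
are realized by an element of `U_V(E(G))`. -/
theorem exists_mem_USet (hV : IsShiftInvariant V) (hg : IsFrameFor (translates g) V)
    {mu : RSpace k → ℕ → ℝ} (hmeas : ∀ i, AEMeasurable (fun x => mu x i) (torusVol k)) {M : ℝ}
    (h : ∀ᵐ x ∂(torusVol k), (Antitone (mu x) ∧ (∀ i, 0 ≤ mu x i) ∧ mu x 0 ≤ M) ∧
      (∀ i, dimFn V x ≤ i → mu x i = 0) ∧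
      (∀ i < dimFn V x, eigSeq (fiber (frameOp (translates g)) x) i ≤ mu x i) ∧
      ∀ i, mu x (i + (n - dimFn V x)) ≤ eigSeq (fiber (frameOp (translates g)) x) i) :
    ∃ C ∈ USet V g, ∀ᵐ x ∂(torusVol k), ∀ i, mu x i = eigSeq (fiber C x) i := by
  have := hV.1.completeSpace_coe
  obtain ⟨s, hs, hsel⟩ := exists_measurable_completion n
  have hγ : ∀ i, AEStronglyMeasurable (Gam (g i)) (torusVol k) := fun i =>
    aestronglyMeasurable_gam (g i)
  set γ : RSpace k → Fin n → Seq2 k := fun x i => Gam (g i) x with hγdef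
  -- The pointwise problem depends on `x` only through these finitely many numbers, so the selection
  -- composed with `p` is measurable.
  set p : RSpace k → (Fin n → Fin n → ℂ) × (Fin n → ℝ) := fun x =>
    (fun a b => inner ℂ (γ x a) (γ x b), fun i => mu x i) with hpdef
  have hp : AEMeasurable p (torusVol k) :=
    (aemeasurable_pi_iff.2 fun a => aemeasurable_pi_iff.2 fun b =>
      ((hγ a).inner (hγ b)).aemeasurable).prodMk (aemeasurable_pi_iff.2 fun i => hmeas i)
  have hZ : AEMeasurable (fun x => (s (p x)).2) (torusVol k) :=
    (measurable_snd.comp hs).comp_aemeasurable hp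
  set Ψ : RSpace k → Fin n → Seq2 k := fun x => combine (s (p x)).2 (γ x) with hΨ
  have hΨm : ∀ j, AEStronglyMeasurable (fun x => Ψ x j) (torusVol k) := fun j => by
    simp only [hΨ, combine]
    refine Finset.aestronglyMeasurable_fun_sum _ fun a _ => ?_
    exact (aemeasurable_pi_iff.1 (aemeasurable_pi_iff.1 hZ a) j).aestronglyMeasurable.smul (hγ a)
  have hS := isFiberField_frameOp hg.isBessel
  -- Interlacing makes the pointwise problem solvable, so the selected coefficients solve it almost
  -- everywhere.
  have hcomp : ∀ᵐ x ∂(torusVol k), ∃ d ≤ n,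
      IsCompletion d (fun a b => inner ℂ (γ x a) (γ x b)) (fun i : Fin n => mu x i)
        (s (p x)).1 (s (p x)).2 := by
    filter_upwards [h, hS.fiber_ae_eq, rangeFn_eq_span hV hg] with x hx h1 hJ
    obtain ⟨⟨ha, -, -⟩, hx1, hx2, hx3⟩ := hx
    refine hsel (p x) ?_
    have hd : dimFn V x = Module.finrank ℂ (Submodule.span ℂ (Set.range (γ x))) := by
      rw [dimFn, hJ]
    have hdn : Module.finrank ℂ (Submodule.span ℂ (Set.range (γ x))) ≤ n := 
      (finrank_range_le_card (R := ℂ) (γ x)).trans_eq (Fintype.card_fin n)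
    have hfin := FiniteDimensional.span_of_finite ℂ (Set.finite_range (γ x))
    obtain ⟨e, lam, hlam, he⟩ := exists_isSpectral (rankSum_self_isPositive (γ x))
      (J := Submodule.span ℂ (Set.range (γ x))) fun w => by
        rw [rankSum_apply]
        exact Submodule.sum_mem _ fun i _ =>
          Submodule.smul_mem _ _ (Submodule.subset_span ⟨i, rfl⟩)
    rw [hd] at hx1 hx2 hx3
    replace h1 : fiber (frameOp (translates g)) x = rankSum (γ x) (γ x) := h1
    rw [h1] at hx2 hx3
    simp only [eigSeq_eq hlam] at hx2 hx3
    exact ⟨_, hdn, exists_isCompletion hdn hlam he ha hx1 hx2 hx3⟩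
  have hΨb : ∀ j, ∀ᵐ x ∂(torusVol k), ‖Ψ x j‖ ≤ Real.sqrt (max M 0) := fun j => by
    filter_upwards [h, hcomp] with x hx hc
    obtain ⟨d, -, hc⟩ := hc
    exact Real.le_sqrt_of_sq_le (hc.norm_combine_sq_le (le_max_right _ _)
      (fun i => ((hx.1.1 (Nat.zero_le _)).trans hx.1.2.2).trans (le_max_left _ _)) j)
  choose φ hφ using fun j => exists_gam_eq (MemLp.of_bound (p := 2) (hΨm j) _ (hΨb j))
  have hφB : IsBessel (translates φ) := isBessel_translates fun j => ⟨Real.sqrt (max M 0), by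
    filter_upwards [hφ j, hΨb j] with x h1 h2
    rwa [h1]⟩
  have hφV : ∀ j, φ j ∈ V := fun j => mem_of_gam_mem_span hV hg <| by
    filter_upwards [hφ j] with x hx
    rw [hx]
    exact combine_mem_span _ _ _
  have hT := isFiberField_frameOp hφB
  refine ⟨_, ⟨frameOp (translates φ), frameOp_isPositive _, frameOp_shift hφB,
    frameOp_mem hφB fun q => hV.2 _ _ (hφV _), ?_, rfl⟩, ?_⟩
  · filter_upwards [hT.fiber_ae_eq, ae_all_iff.2 hφ, hcomp, rangeFn_eq_span hV hg]
      with x h1 h2 hc hJ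
    obtain ⟨d, hdn, hc⟩ := hc
    simp only [h2] at h1
    have hr : LinearMap.rank (fiber (frameOp (translates φ)) x : Seq2 k →ₗ[ℂ] Seq2 k) ≤
        ((n - d : ℕ) : Cardinal) := by
      rw [h1]
      exact rank_rankSum_le _ _ fun j hj => hc.combine_eq_zero (by omega)
    -- The rank is at most `n - d` for the selected `d`; this inequality turns it into the bound
    -- involving `dimFn V x`.
    have hd : dimFn V x ≤ d := by
      rw [dimFn, hJ]
      exact hc.finrank_span_le
    refine (add_le_add hr (Nat.cast_le.2 hd)).trans ?_
    rw [← Nat.cast_add, Nat.sub_add_cancel hdn]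
  · filter_upwards [h, (hS.add hT).fiber_ae_eq, ae_all_iff.2 hφ, hcomp, rangeFn_eq_span hV hg]
      with x hx h1 h2 hc hJ i
    obtain ⟨d, hdn, hc⟩ := hc
    simp only [h2] at h1
    rw [h1]
    refine (eigSeq_eq (hc.isSpectral hdn hx.1.1 hx.1.2.1 fun i hi =>
      hx.2.1 i (le_trans ?_ hi)) i).symm
    rw [dimFn, hJ]
    exact hc.finrank_span_le.trans hdn

theorem dimFn_eq_zero {x : RSpace k} (hx : x ∈ torus k) (h : x ∉ Spec V) : dimFn V x = 0 := by
  have : rangeFn V x = ⊥ := by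
    by_contra h'
    exact h ⟨hx, h'⟩
  rw [dimFn, this, finrank_bot]

theorem dimFn_le (hV : IsShiftInvariant V) (hg : IsFrameFor (translates g) V) :
    ∀ᵐ x ∂(torusVol k), dimFn V x ≤ n := by
  filter_upwards [rangeFn_eq_span hV hg] with x hx
  rw [dimFn, hx]
  exact (finrank_range_le_card fun i => Gam (g i) x).trans_eq (Fintype.card_fin n)

theorem eigSeq_nonneg (T : Seq2 k →L[ℂ] Seq2 k) (j : ℕ) : 0 ≤ eigSeq T j :=
  Real.sSup_nonneg fun _ ht => ht.1

end

end SISpace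

end

/-! ### The equivalence -/

theorem mainTheorem7 {k n : ℕ} (V : Submodule ℂ (SISpace.L2 k))
    (hV : SISpace.IsShiftInvariant V)
    (g : Fin n → SISpace.L2 k)
    (hg : SISpace.IsFrameFor (SISpace.translates g) V)
    (X : Set (SISpace.RSpace k)) (hX : NullMeasurableSet X volume)
    (hXT : X ⊆ SISpace.torus k)
    (hSpec : ∀ᵐ x, x ∈ SISpace.Spec V → x ∈ X)
    (μ : SISpace.RSpace k → ℕ → ℝ)
    (hμmeas : ∀ i, AEMeasurable (fun x => μ x i) (volume.restrict X))
    (hμ : ∀ x ∈ X, Antitone (μ x) ∧ (∀ i, 0 ≤ μ x i) ∧ Summable (μ x)) :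
    (∃ C ∈ SISpace.USet V g,
      ∀ᵐ x ∂(volume.restrict X), ∀ i, μ x i = SISpace.eigSeq (SISpace.fiber C x) i) ↔
    ((∃ M : ℝ, ∀ᵐ x ∂(volume.restrict X), μ x 0 ≤ M) ∧
      ∀ᵐ x ∂(volume.restrict X),
        let lam : ℕ → ℝ :=
          SISpace.eigSeq (SISpace.fiber (SISpace.frameOp (SISpace.translates g)) x)
        let d : ℕ := SISpace.dimFn V x
        let m : ℤ := 2 * (d : ℤ) - (n : ℤ)
        (x ∉ SISpace.Spec V → ∀ i, μ x i = 0) ∧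
        (x ∈ SISpace.Spec V →
          (∀ i, d ≤ i → μ x i = 0) ∧
          (m ≤ 0 → ∀ i < d, lam i ≤ μ x i) ∧
          (1 ≤ m → (∀ i < d, lam i ≤ μ x i) ∧
            ∀ i : ℕ, (i : ℤ) < m → μ x (n - d + i) ≤ lam i))) := by
  have hX' : NullMeasurableSet X (SISpace.torusVol k) :=
    hX.mono_ac Measure.restrict_le_self.absolutelyContinuous
  have hres : (SISpace.torusVol k).restrict X = volume.restrict X :=
    Measure.restrict_restrict_of_subset hXT
  have hto : ∀ {p : SISpace.RSpace k → Prop}, (∀ᵐ x ∂(SISpace.torusVol k), p x) →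
      ∀ᵐ x ∂(volume.restrict X), p x := fun h => ae_restrict_of_ae_restrict_of_subset hXT h
  constructor
  · rintro ⟨C, hC, hμC⟩
    obtain ⟨M, hM⟩ := SISpace.eigSeq_fiber_of_mem_USet hV hg hC
    refine ⟨⟨M, ?_⟩, ?_⟩
    · filter_upwards [hμC, hto hM] with x h1 h2
      exact (h1 0).trans_le h2.1
    · filter_upwards [hμC, hto hM, ae_restrict_mem₀ hX] with x h1 h2 hxX
      obtain ⟨-, h3, h4, h5⟩ := h2
      simp only [← h1] at h3 h4 h5
      -- Both inequalities hold for all indices, whatever the sign of `m`; off the spectrum `d = 0`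
      -- and all eigenvalues vanish.
      exact ⟨fun hx i => h3 i (by rw [SISpace.dimFn_eq_zero (hXT hxX) hx]; exact i.zero_le),
        fun _ => ⟨h3, fun _ i _ => h4 i, fun _ => ⟨fun i _ => h4 i, fun i _ => h5 i⟩⟩⟩
  · rintro ⟨⟨M, hM⟩, hmain⟩
    classical
    -- Extension by zero from `X` to the cube; outside `X` almost every point has `d = 0`, so the
    -- interlacing conditions hold there trivially.
    set mu : SISpace.RSpace k → ℕ → ℝ := fun x i => X.indicator (fun x => μ x i) x with hmu
    have hmuX : ∀ x ∈ X, mu x = μ x := fun x hx => funext fun i => Set.indicator_of_mem hx _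
    have hmu0 : ∀ x ∉ X, mu x = 0 := fun x hx => funext fun i => Set.indicator_of_notMem hx _
    have hmeas : ∀ i, AEMeasurable (fun x => mu x i) (SISpace.torusVol k) := fun i => by
      refine (aemeasurable_indicator_iff₀ hX').2 ?_
      rw [hres]
      exact hμmeas i
    obtain ⟨C, hC, hCmu⟩ := SISpace.exists_mem_USet hV hg hmeas (M := max M 0) <| by
      rw [ae_restrict_iff'₀ hX] at hM hmain
      filter_upwards [ae_restrict_of_ae hM, ae_restrict_of_ae hmain, ae_restrict_of_ae hSpec,
        SISpace.ae_mem_torus k, SISpace.dimFn_le hV hg] with x h1 h2 h3 hxT hdn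
      have hlam := SISpace.eigSeq_nonneg
        (SISpace.fiber (SISpace.frameOp (SISpace.translates g)) x)
      by_cases hxX : x ∈ X
      · rw [hmuX x hxX]
        obtain ⟨ha, hn, -⟩ := hμ x hxX
        refine ⟨⟨ha, hn, (h1 hxX).trans (le_max_left _ _)⟩, ?_⟩
        obtain ⟨h4, h5⟩ := h2 hxX
        by_cases hxS : x ∈ SISpace.Spec V
        · obtain ⟨h6, h7, h8⟩ := h5 hxS
          refine ⟨h6, ?_, fun i => ?_⟩
          · rcases le_or_gt (2 * (SISpace.dimFn V x : ℤ) - n) 0 with h | h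
            · exact h7 h
            · exact (h8 h).1
          -- For `i ≥ m` the index `i + (n - d)` is at least `d`, so `μ` vanishes there and the
          -- upper inequality is automatic.
          · rcases lt_or_ge (i : ℤ) (2 * (SISpace.dimFn V x : ℤ) - n) with h | h
            · rw [add_comm]
              exact (h8 (by omega)).2 i h
            · rw [h6 _ (by omega)]
              exact hlam i
        · rw [SISpace.dimFn_eq_zero hxT hxS]
          exact ⟨fun i _ => h4 hxS i, fun i hi => absurd hi i.not_lt_zero,
            fun i => (h4 hxS _).trans_le (hlam i)⟩
      · have hxS : x ∉ SISpace.Spec V := fun h => hxX (h3 h)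
        rw [hmu0 x hxX, SISpace.dimFn_eq_zero hxT hxS]
        exact ⟨⟨antitone_const, fun _ => le_rfl, le_max_right _ _⟩, fun _ _ => rfl,
          fun i hi => absurd hi i.not_lt_zero, fun i => hlam i⟩
    refine ⟨C, hC, ?_⟩
    filter_upwards [hto hCmu, ae_restrict_mem₀ hX] with x h1 hxX i
    rw [← h1, hmuX x hxX]
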